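/- Let $k$ be a field. A cyclic module $C$ is a simplicial $k$-vector space $(C_n,\delta_i,s_i)$ with operators $\tau_n\colon C_n\to C_n$ such that $\tau_n^{n+1}=1$, $\delta_0\tau_n=\delta_n$, $\delta_i\tau_n=\tau_{n-1}\delta_{i-1}$, $s_0\tau_n=\tau_{n+1}^2s_n$ and $s_i\tau_n=\tau_{n+1}s_{i-1}$ for $1\le i\le n$. It defines a mixed complex $(C,b,B)$ with $b=\sum_i(-1)^i\delta_i$ and $B=(1-t)s_{-1}N$, where $t=(-1)^n\tau_n$ on $C_n$, $N=1+t+\dots+t^n$, $s_{-1}=\tau_{n+1}s_n$; these operators descend to the normalized mixed complex $(\overline C,b,B)$, where $\overline C_n=C_n/\sum_i s_i(C_{n-1})$. For a mixed complex $M=(M_n)_{n\ge 0}$ put $\mathrm{Tot}_n(M)=M_n\oplus M_{n-2}\oplus M_{n-4}\oplus\cdots$ with differential $b+B$, let $HC_n(M)$ be its homology, and let $S\colon HC_{n+2}(M)\to HC_n(M)$ be the periodicity map induced by the projection $\mathrm{Tot}_{n+2}\to\mathrm{Tot}_n$. Let $HP_0(M)$ and $HP_1(M)$ be the even and odd homology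 of the supercomplex $\varprojlim_S\mathrm{Tot}(M)=\prod_n M_{2n}\oplus\prod_n M_{2n+1}$ with differential $b+B$. For mixed complexes $M,M'$ let $M\otimes M'$ be the mixed complex with $(M\otimes M')_n=\bigoplus_{p+q=n}M_p\otimes M'_q$ and operators $b\otimes 1+(-1)^p\,1\otimes b'$ and $B\otimes 1+(-1)^p\,1\otimes B'$ on $M_p\otimes M'_q$. For $\mathbb Z/2$-graded spaces, $(V\widehat\otimes W)_0=V_0\otimes W_0\oplus V_1\otimes W_1$ and $(V\widehat\otimes W)_1=V_0\otimes W_1\oplus V_1\otimes W_0$; for supercomplexes the differential is $\partial(x\otimes y)=\partial x\otimes y+(-1)^{|x|}x\otimes\partial y$. The map of supercomplexes $$\nabla\colon \varprojlim\mathrm{Tot}(M)\,\widehat\otimes\,\varprojlim\mathrm{Tot}(M')\to\varprojlim\mathrm{Tot}(M\otimes M'),\qquad \{\xi_p\}_p\otimes\{\xi'_q\}_q\mapsto\Big\{\sum_{p+q=n}\xi_p\otimes\xi'_q\Big\}_n,$$ together with $[x]\otimes[y]\mapsto[x\otimes y]$, induces $\nabla\colon HP_*(M)\widehat\otimes HP_*(M')\to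 HP_*(M\otimes M')$. **Theorem.** Let $C$ be a cyclic module over $k$, let $C'$ be any cyclic module over $k$, and let either $M=\overline C$, $M'=\overline{C'}$ be their normalized mixed complexes, or $M=C$, $M'=C'$ their unnormalized ones. Suppose that (i) the inverse system $(HC(M)[-2m],S)_m$ satisfies the Mittag-Leffler condition, that is, for all $n,j\ge0$ the images of $S^{i-j}\colon HC_{n+2i}(M)\to HC_{n+2j}(M)$ are the same for all sufficiently large $i$; and (ii) $HP_*(M)=HP_0(M)\oplus HP_1(M)$ is finite-dimensional. Then $\nabla\colon HP_*(M)\widehat\otimes HP_*(M')\to HP_*(M\otimes M')$ is an isomorphism; that is, $\nabla$ gives isomorphisms $$HP_0(M)\otimes HP_0(M')\oplus HP_1(M)\otimes HP_1(M')\cong HP_0(M\otimes M'),$$ $$HP_0(M)\otimes HP_1(M')\oplus HP_1(M)\otimes HP_0(M')\cong HP_1(M\otimes M').$$ -/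

import Mathlib

open CategoryTheory TensorProduct

universe u v w

noncomputable section

/-- A mixed complex of `k`-vector spaces, concentrated in nonnegative degrees: a graded space
with `b` of degree `-1` and `B` of degree `+1` such that `b² = B² = bB + Bb = 0`
(in degree `0` one has `b = 0`, whence the separate field `b_comp_B_zero`). -/
structure MixedComplex (k : Type u) [Field k] where
  V : ℕ → Type v
  [addCommGroup : ∀ n, AddCommGroup (V n)]
  [module : ∀ n, Module k (V n)]
  b : ∀ n, V (n + 1) →ₗ[k] V n
  B : ∀ n, V n →ₗ[k] V (n + 1)
  b_comp_b : ∀ n, b n ∘ₗ b (n + 1) = 0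
  B_comp_B : ∀ n, B (n + 1) ∘ₗ B n = 0
  b_comp_B_zero : b 0 ∘ₗ B 0 = 0
  b_comp_B_add : ∀ n, b (n + 1) ∘ₗ B (n + 1) + B n ∘ₗ b n = 0

attribute [instance] MixedComplex.addCommGroup MixedComplex.module

open Simplicial in
/-- A cyclic module (a cyclic object in `k`-vector spaces): a simplicial vector space with
operators `τ_n` on `C_n` satisfying `τ_n ^ (n+1) = 1`, `δ_0 τ_n = δ_n`, `δ_i τ_n = τ_{n-1} δ_{i-1}`,
`s_0 τ_n = τ_{n+1}² s_n` and `s_i τ_n = τ_{n+1} s_{i-1}` for `1 ≤ i ≤ n`. (Compositions `f ≫ g` are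
in diagrammatic order.) -/
structure CyclicModule (k : Type u) [Field k] where
  X : SimplicialObject (ModuleCat.{v} k)
  τ : ∀ n : ℕ, X _⦋n⦌ ⟶ X _⦋n⦌
  τ_pow : ∀ n : ℕ, (τ n).hom ^ (n + 1) = 1
  τ_δ_zero : ∀ n : ℕ, τ (n + 1) ≫ X.δ (0 : Fin (n + 2)) = X.δ (Fin.last (n + 1))
  τ_δ_succ : ∀ (n : ℕ) (i : Fin (n + 1)), τ (n + 1) ≫ X.δ i.succ = X.δ i.castSucc ≫ τ n
  τ_σ_zero : ∀ n : ℕ, τ n ≫ X.σ (0 : Fin (n + 1)) = X.σ (Fin.last n) ≫ τ (n + 1) ≫ τ (n + 1)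
  τ_σ_succ : ∀ (n : ℕ) (i : Fin (n + 1)),
    τ (n + 1) ≫ X.σ i.succ = X.σ i.castSucc ≫ τ (n + 2)

namespace CyclicModule

variable {k : Type u} [Field k] (C : CyclicModule.{u, v} k)

lemma finsetSum_comp {ι M₁ M₂ M₃ : Type*} [AddCommGroup M₁] [AddCommGroup M₂] [AddCommGroup M₃]
    [Module k M₁] [Module k M₂] [Module k M₃] (S : Finset ι) (f : ι → M₂ →ₗ[k] M₃)
    (g : M₁ →ₗ[k] M₂) : (∑ i ∈ S, f i) ∘ₗ g = ∑ i ∈ S, f i ∘ₗ g := by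
  ext x; simp

lemma comp_finsetSum {ι M₁ M₂ M₃ : Type*} [AddCommGroup M₁] [AddCommGroup M₂] [AddCommGroup M₃]
    [Module k M₁] [Module k M₂] [Module k M₃] (S : Finset ι) (f : ι → M₁ →ₗ[k] M₂)
    (g : M₂ →ₗ[k] M₃) : g ∘ₗ (∑ i ∈ S, f i) = ∑ i ∈ S, g ∘ₗ f i := by
  ext x; simp

open Simplicial in
/-- The space of `n`-chains `C_n`. -/
abbrev ch (n : ℕ) : Type v := C.X _⦋n⦌

/-- The faces `δ_i : C_{n+1} → C_n`, as linear maps. -/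
def d (n : ℕ) (i : Fin (n + 2)) : C.ch (n + 1) →ₗ[k] C.ch n := (C.X.δ i).hom

/-- The degeneracies `s_i : C_n → C_{n+1}`, as linear maps. -/
def s (n : ℕ) (i : Fin (n + 1)) : C.ch n →ₗ[k] C.ch (n + 1) := (C.X.σ i).hom

/-- The signed cyclic operator `t_n = (-1)^n τ_n`. -/
def t (n : ℕ) : C.ch n →ₗ[k] C.ch n := (-1 : k) ^ n • (C.τ n).hom

/-- The norm operator `N = 1 + t + ⋯ + t^n` on `C_n`. -/
def N (n : ℕ) : C.ch n →ₗ[k] C.ch n := ∑ j ∈ Finset.range (n + 1), C.t n ^ j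

/-- The extra degeneracy `s_{-1} = τ_{n+1} s_n : C_n → C_{n+1}`. -/
def sExtra (n : ℕ) : C.ch n →ₗ[k] C.ch (n + 1) := (C.τ (n + 1)).hom ∘ₗ C.s n (Fin.last n)

/-- The Hochschild differential `b = ∑ (-1)^i δ_i : C_{n+1} → C_n`. -/
def b (n : ℕ) : C.ch (n + 1) →ₗ[k] C.ch n :=
  ∑ i : Fin (n + 2), (-1 : k) ^ (i : ℕ) • C.d n i

/-- Connes' differential `B = (1 - t) s_{-1} N : C_n → C_{n+1}`. -/
def B (n : ℕ) : C.ch n →ₗ[k] C.ch (n + 1) :=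
  (LinearMap.id - C.t (n + 1)) ∘ₗ C.sExtra n ∘ₗ C.N n

/-- The truncated differential `b' = ∑_{i ≤ n} (-1)^i δ_i : C_{n+1} → C_n`, used only to check the
mixed complex identities. -/
def b' (n : ℕ) : C.ch (n + 1) →ₗ[k] C.ch n :=
  ∑ i : Fin (n + 1), (-1 : k) ^ (i : ℕ) • C.d n i.castSucc

lemma b_eq (n : ℕ) : C.b n = C.b' n + (-1 : k) ^ (n + 1) • C.d n (Fin.last (n + 1)) := by
  rw [b, Fin.sum_univ_castSucc]; rfl

lemma d_zero_t (n : ℕ) :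
    C.d n 0 ∘ₗ C.t (n + 1) = (-1 : k) ^ (n + 1) • C.d n (Fin.last (n + 1)) := by
  have := congrArg ModuleCat.Hom.hom (C.τ_δ_zero n)
  rw [ModuleCat.hom_comp] at this
  rw [t, LinearMap.comp_smul]
  exact congrArg _ this

lemma d_succ_τ (n : ℕ) (i : Fin (n + 1)) :
    C.d n i.succ ∘ₗ (C.τ (n + 1)).hom = (C.τ n).hom ∘ₗ C.d n i.castSucc := by
  have := congrArg ModuleCat.Hom.hom (C.τ_δ_succ n i)
  rw [ModuleCat.hom_comp, ModuleCat.hom_comp] at this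
  exact this

lemma d_succ_t (n : ℕ) (i : Fin (n + 1)) :
    C.d n i.succ ∘ₗ C.t (n + 1) = - (C.t n ∘ₗ C.d n i.castSucc) := by
  rw [t, LinearMap.comp_smul, d_succ_τ, t, LinearMap.smul_comp, pow_succ]
  simp

lemma b_comp_one_sub_t (n : ℕ) :
    C.b n ∘ₗ (LinearMap.id - C.t (n + 1)) = (LinearMap.id - C.t n) ∘ₗ C.b' n := by
  have h : C.b n ∘ₗ C.t (n + 1) =
      (-1 : k) ^ (n + 1) • C.d n (Fin.last (n + 1)) + C.t n ∘ₗ C.b' n := by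
    rw [b, b', Fin.sum_univ_succ, LinearMap.add_comp, LinearMap.smul_comp, d_zero_t,
      finsetSum_comp, comp_finsetSum]
    congr 1
    · simp
    · refine Finset.sum_congr rfl fun i _ => ?_
      rw [LinearMap.smul_comp, d_succ_t, LinearMap.comp_smul, Fin.val_succ, pow_succ]
      simp
  rw [LinearMap.comp_sub, h, LinearMap.sub_comp, LinearMap.comp_id, LinearMap.id_comp, b_eq]
  abel

lemma t_pow (n : ℕ) : C.t n ^ (n + 1) = 1 := by
  rw [t, smul_pow, C.τ_pow, ← pow_mul, Even.neg_one_pow (Nat.even_mul_succ_self n), one_smul]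

lemma t_mul_N (n : ℕ) : C.t n * C.N n = C.N n := by
  have h1 := Finset.sum_range_succ (fun j => C.t n ^ j) (n + 1)
  have h2 := Finset.sum_range_succ' (fun j => C.t n ^ j) (n + 1)
  rw [N, Finset.mul_sum]
  simp only [← pow_succ']
  rw [h2, t_pow, pow_zero] at h1
  exact add_right_cancel h1

lemma N_mul_t (n : ℕ) : C.N n * C.t n = C.N n := by
  have : Commute (C.t n) (C.N n) := by
    rw [N]; exact Commute.sum_right _ _ _ fun j _ => Commute.pow_right (Commute.refl _) j
  rw [← this.eq, t_mul_N]

lemma t_pow_mul_N (n j : ℕ) : C.t n ^ j * C.N n = C.N n := by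
  induction j with
  | zero => simp
  | succ j ih => rw [pow_succ, mul_assoc, t_mul_N, ih]

lemma N_mul_t_pow (n j : ℕ) : C.N n * C.t n ^ j = C.N n := by
  induction j with
  | zero => simp
  | succ j ih => rw [pow_succ, ← mul_assoc, ih, N_mul_t]

lemma N_comp_one_sub_t (n : ℕ) : C.N n ∘ₗ (LinearMap.id - C.t n) = 0 := by
  rw [LinearMap.comp_sub, LinearMap.comp_id, ← Module.End.mul_eq_comp, N_mul_t, sub_self]

lemma one_sub_t_comp_N (n : ℕ) : (LinearMap.id - C.t n) ∘ₗ C.N n = 0 := by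
  rw [LinearMap.sub_comp, LinearMap.id_comp, ← Module.End.mul_eq_comp, t_mul_N, sub_self]

lemma signed_d_comp_t_pow (n : ℕ) (i : Fin (n + 2)) :
    ((-1 : k) ^ (i : ℕ) • C.d n i) ∘ₗ (C.t (n + 1) ^ (i : ℕ)) =
      (C.t n ^ (i : ℕ)) ∘ₗ C.d n 0 := by
  induction i using Fin.induction with
  | zero => ext x; simp
  | succ i ih =>
    have h : ((-1 : k) ^ (i.succ : ℕ) • C.d n i.succ) ∘ₗ C.t (n + 1) =
        C.t n ∘ₗ ((-1 : k) ^ (i.castSucc : ℕ) • C.d n i.castSucc) := by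
      rw [LinearMap.smul_comp, d_succ_t, LinearMap.comp_smul, Fin.val_succ, pow_succ]
      simp
    calc ((-1 : k) ^ (i.succ : ℕ) • C.d n i.succ) ∘ₗ (C.t (n + 1) ^ (i.succ : ℕ))
        = (((-1 : k) ^ (i.succ : ℕ) • C.d n i.succ) ∘ₗ C.t (n + 1)) ∘ₗ
            C.t (n + 1) ^ (i.castSucc : ℕ) := by
          rw [LinearMap.comp_assoc, ← Module.End.mul_eq_comp, ← pow_succ']; rfl
      _ = C.t n ∘ₗ (C.t n ^ (i.castSucc : ℕ)) ∘ₗ C.d n 0 := by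
          rw [h, LinearMap.comp_assoc, ih]
      _ = _ := by
          rw [← LinearMap.comp_assoc, ← Module.End.mul_eq_comp, ← pow_succ']; rfl

lemma b'_comp_N (n : ℕ) : C.b' n ∘ₗ C.N (n + 1) = C.N n ∘ₗ C.b n := by
  have h1 : C.b' n ∘ₗ C.N (n + 1) = C.N n ∘ₗ C.d n 0 ∘ₗ C.N (n + 1) := by
    have h0 : C.N n ∘ₗ C.d n 0 ∘ₗ C.N (n + 1) =
        ∑ j ∈ Finset.range (n + 1), (C.t n ^ j) ∘ₗ C.d n 0 ∘ₗ C.N (n + 1) := by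
      rw [← finsetSum_comp]; rfl
    rw [h0, b', finsetSum_comp, ← Fin.sum_univ_eq_sum_range
      (fun j => (C.t n ^ j) ∘ₗ C.d n 0 ∘ₗ C.N (n + 1))]
    refine Finset.sum_congr rfl fun i _ => ?_
    have := C.signed_d_comp_t_pow n i.castSucc
    rw [← LinearMap.comp_assoc, ← Fin.val_castSucc, ← this, LinearMap.comp_assoc,
      ← Module.End.mul_eq_comp, t_pow_mul_N]
  have h2 : C.N n ∘ₗ C.b n = C.N n ∘ₗ C.d n 0 ∘ₗ C.N (n + 1) := by
    have h3 : ∀ i : Fin (n + 2), C.N n ∘ₗ ((-1 : k) ^ (i : ℕ) • C.d n i) =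
        C.N n ∘ₗ C.d n 0 ∘ₗ C.t (n + 1) ^ (n + 2 - (i : ℕ)) := by
      intro i
      have h4 : C.t (n + 1) ^ (i : ℕ) * C.t (n + 1) ^ (n + 2 - (i : ℕ)) = 1 := by
        rw [← pow_add, Nat.add_sub_cancel' (by omega), t_pow]
      have h5 := C.signed_d_comp_t_pow n i
      calc C.N n ∘ₗ ((-1 : k) ^ (i : ℕ) • C.d n i)
          = C.N n ∘ₗ ((-1 : k) ^ (i : ℕ) • C.d n i) ∘ₗ
              (C.t (n + 1) ^ (i : ℕ) * C.t (n + 1) ^ (n + 2 - (i : ℕ))) := by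
            rw [h4]; rfl
        _ = C.N n ∘ₗ (((-1 : k) ^ (i : ℕ) • C.d n i) ∘ₗ C.t (n + 1) ^ (i : ℕ)) ∘ₗ
              C.t (n + 1) ^ (n + 2 - (i : ℕ)) := rfl
        _ = (C.N n * C.t n ^ (i : ℕ)) ∘ₗ C.d n 0 ∘ₗ C.t (n + 1) ^ (n + 2 - (i : ℕ)) := by
            rw [h5]; rfl
        _ = _ := by rw [N_mul_t_pow]
    have h6 : C.N (n + 1) = ∑ i : Fin (n + 2), C.t (n + 1) ^ (n + 2 - (i : ℕ)) := by
      rw [← C.t_mul_N (n + 1), N, Finset.mul_sum,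
        Fin.sum_univ_eq_sum_range (fun i => C.t (n + 1) ^ (n + 2 - i)),
        ← Finset.sum_range_reflect]
      refine Finset.sum_congr rfl fun i hi => ?_
      have := Finset.mem_range.1 hi
      rw [← pow_succ']
      congr 1; omega
    rw [b, comp_finsetSum, Finset.sum_congr rfl fun i _ => h3 i, h6, comp_finsetSum,
      comp_finsetSum]
  rw [h1, h2]

lemma d_succ_sExtra (n : ℕ) (i : Fin (n + 1)) :
    C.d (n + 1) i.succ.castSucc ∘ₗ C.sExtra (n + 1) = C.sExtra n ∘ₗ C.d n i.castSucc := by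
  have h := congrArg ModuleCat.Hom.hom (C.X.δ_comp_σ_of_le (i := i.castSucc) (j := Fin.last n)
    (by rw [Fin.castSucc_le_castSucc_iff]; exact Fin.le_last i))
  rw [ModuleCat.hom_comp, ModuleCat.hom_comp] at h
  rw [← Fin.succ_castSucc, sExtra, ← LinearMap.comp_assoc, d_succ_τ, LinearMap.comp_assoc]
  exact congrArg _ h

lemma d_zero_sExtra (n : ℕ) : C.d n 0 ∘ₗ C.sExtra n = LinearMap.id := by
  have h := congrArg ModuleCat.Hom.hom (C.τ_δ_zero n)
  have h' := congrArg ModuleCat.Hom.hom (C.X.δ_comp_σ_succ (i := Fin.last n))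
  rw [ModuleCat.hom_comp] at h h'
  rw [sExtra, ← LinearMap.comp_assoc]
  refine (congrArg (fun f => f ∘ₗ C.s n (Fin.last n)) h).trans h'

lemma b'_comp_sExtra_zero : C.b' 0 ∘ₗ C.sExtra 0 = LinearMap.id := by
  rw [b', Fin.sum_univ_one, Fin.castSucc_zero, LinearMap.smul_comp, d_zero_sExtra]
  simp

lemma b'_comp_sExtra (n : ℕ) :
    C.b' (n + 1) ∘ₗ C.sExtra (n + 1) = LinearMap.id - C.sExtra n ∘ₗ C.b' n := by
  rw [b', Fin.sum_univ_succ, LinearMap.add_comp, finsetSum_comp, b', comp_finsetSum,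
    Fin.castSucc_zero, LinearMap.smul_comp, d_zero_sExtra, sub_eq_add_neg,
    ← Finset.sum_neg_distrib]
  congr 1
  · simp
  · refine Finset.sum_congr rfl fun i _ => ?_
    rw [LinearMap.smul_comp, d_succ_sExtra, LinearMap.comp_smul, Fin.val_succ, pow_succ]
    simp

lemma b_comp_b (n : ℕ) : C.b n ∘ₗ C.b (n + 1) = 0 := by
  have h := congrArg ModuleCat.Hom.hom (AlgebraicTopology.AlternatingFaceMapComplex.d_squared C.X n)
  have e : ∀ m, C.b m = (AlgebraicTopology.AlternatingFaceMapComplex.objD C.X m).hom := by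
    intro m
    ext x
    simp only [b, d, AlgebraicTopology.AlternatingFaceMapComplex.objD, LinearMap.sum_apply,
      LinearMap.smul_apply, ModuleCat.hom_sum, ModuleCat.hom_zsmul]
    refine Finset.sum_congr rfl fun i _ => ?_
    rw [← Int.cast_smul_eq_zsmul k]
    push_cast
    rfl
  rw [ModuleCat.hom_comp] at h
  rw [e, e]
  exact h

lemma B_comp_B (n : ℕ) : C.B (n + 1) ∘ₗ C.B n = 0 := by
  calc C.B (n + 1) ∘ₗ C.B n = (LinearMap.id - C.t (n + 2)) ∘ₗ C.sExtra (n + 1) ∘ₗ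
      (C.N (n + 1) ∘ₗ (LinearMap.id - C.t (n + 1))) ∘ₗ C.sExtra n ∘ₗ C.N n := rfl
    _ = 0 := by rw [N_comp_one_sub_t]; simp

lemma b_comp_B_zero : C.b 0 ∘ₗ C.B 0 = 0 := by
  calc C.b 0 ∘ₗ C.B 0 = (C.b 0 ∘ₗ (LinearMap.id - C.t 1)) ∘ₗ C.sExtra 0 ∘ₗ C.N 0 := rfl
    _ = (LinearMap.id - C.t 0) ∘ₗ (C.b' 0 ∘ₗ C.sExtra 0) ∘ₗ C.N 0 := by
      rw [b_comp_one_sub_t]; rfl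
    _ = 0 := by rw [b'_comp_sExtra_zero, LinearMap.id_comp, one_sub_t_comp_N]

lemma b_comp_B_add (n : ℕ) : C.b (n + 1) ∘ₗ C.B (n + 1) + C.B n ∘ₗ C.b n = 0 := by
  have h : C.b (n + 1) ∘ₗ C.B (n + 1) = - (C.B n ∘ₗ C.b n) := by
    calc C.b (n + 1) ∘ₗ C.B (n + 1)
        = (C.b (n + 1) ∘ₗ (LinearMap.id - C.t (n + 2))) ∘ₗ C.sExtra (n + 1) ∘ₗ C.N (n + 1) := rfl
      _ = (LinearMap.id - C.t (n + 1)) ∘ₗ (C.b' (n + 1) ∘ₗ C.sExtra (n + 1)) ∘ₗ C.N (n + 1) := by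
        rw [b_comp_one_sub_t]; rfl
      _ = (LinearMap.id - C.t (n + 1)) ∘ₗ C.N (n + 1) -
          (LinearMap.id - C.t (n + 1)) ∘ₗ C.sExtra n ∘ₗ (C.b' n ∘ₗ C.N (n + 1)) := by
        rw [b'_comp_sExtra, LinearMap.sub_comp (f := C.N (n + 1)),
          LinearMap.comp_sub, LinearMap.id_comp]; rfl
      _ = - (C.B n ∘ₗ C.b n) := by
        rw [one_sub_t_comp_N, b'_comp_N, zero_sub]; rfl
  rw [h, neg_add_cancel]

/-- The mixed complex `(C, b, B)` of a cyclic module. -/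
def mixedComplex : MixedComplex.{u, v} k where
  V := C.ch
  b := C.b
  B := C.B
  b_comp_b := C.b_comp_b
  B_comp_B := C.B_comp_B
  b_comp_B_zero := C.b_comp_B_zero
  b_comp_B_add := C.b_comp_B_add

end CyclicModule

namespace MixedComplex

variable {k : Type u} [Field k]

/-- The quotient of a mixed complex by a graded subspace stable under `b` and `B`. -/
def quotient (M : MixedComplex.{u, v} k) (D : ∀ n, Submodule k (M.V n))
    (hb : ∀ n, D (n + 1) ≤ (D n).comap (M.b n)) (hB : ∀ n, D n ≤ (D (n + 1)).comap (M.B n)) :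
    MixedComplex.{u, v} k where
  V n := M.V n ⧸ D n
  b n := Submodule.mapQ _ _ (M.b n) (hb n)
  B n := Submodule.mapQ _ _ (M.B n) (hB n)
  b_comp_b n := by
    refine Submodule.linearMap_qext _ (LinearMap.ext fun x => ?_)
    have := LinearMap.congr_fun (M.b_comp_b n) x
    simp only [LinearMap.comp_apply, Submodule.mkQ_apply, Submodule.mapQ_apply,
      LinearMap.zero_apply] at this ⊢
    rw [this, Submodule.Quotient.mk_zero]
  B_comp_B n := by
    refine Submodule.linearMap_qext _ (LinearMap.ext fun x => ?_)
    have := LinearMap.congr_fun (M.B_comp_B n) x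
    simp only [LinearMap.comp_apply, Submodule.mkQ_apply, Submodule.mapQ_apply,
      LinearMap.zero_apply] at this ⊢
    rw [this, Submodule.Quotient.mk_zero]
  b_comp_B_zero := by
    refine Submodule.linearMap_qext _ (LinearMap.ext fun x => ?_)
    have := LinearMap.congr_fun M.b_comp_B_zero x
    simp only [LinearMap.comp_apply, Submodule.mkQ_apply, Submodule.mapQ_apply,
      LinearMap.zero_apply] at this ⊢
    rw [this, Submodule.Quotient.mk_zero]
  b_comp_B_add n := by
    refine Submodule.linearMap_qext _ (LinearMap.ext fun x => ?_)
    have := LinearMap.congr_fun (M.b_comp_B_add n) x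
    simp only [LinearMap.comp_apply, LinearMap.add_apply, Submodule.mkQ_apply,
      Submodule.mapQ_apply, LinearMap.zero_apply] at this ⊢
    rw [← Submodule.Quotient.mk_add, this, Submodule.Quotient.mk_zero]

end MixedComplex

namespace CyclicModule

variable {k : Type u} [Field k] (C : CyclicModule.{u, v} k)

/-- The degenerate subspace `D_n ⊆ C_n`: the sum of the images of the degeneracies. -/
def degenerate : ∀ n, Submodule k (C.ch n)
  | 0 => ⊥
  | n + 1 => ⨆ i : Fin (n + 1), LinearMap.range (C.s n i)

lemma s_mem_degenerate (n : ℕ) (i : Fin (n + 1)) (x : C.ch n) :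
    C.s n i x ∈ C.degenerate (n + 1) :=
  Submodule.mem_iSup_of_mem i (LinearMap.mem_range_self _ x)

lemma degenerate_le {n : ℕ} {P : Submodule k (C.ch (n + 1))}
    (h : ∀ i x, C.s n i x ∈ P) : C.degenerate (n + 1) ≤ P :=
  iSup_le fun i => by rintro _ ⟨x, rfl⟩; exact h i x

open Simplicial in
lemma hom_eq {n m l l' : ℕ} {f : C.X _⦋n⦌ ⟶ C.X _⦋l⦌} {g : C.X _⦋l⦌ ⟶ C.X _⦋m⦌}
    {f' : C.X _⦋n⦌ ⟶ C.X _⦋l'⦌} {g' : C.X _⦋l'⦌ ⟶ C.X _⦋m⦌} (h : f ≫ g = f' ≫ g')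
    (x : C.ch n) : g.hom (f.hom x) = g'.hom (f'.hom x) := by
  have := congrArg ModuleCat.Hom.hom h
  rw [ModuleCat.hom_comp, ModuleCat.hom_comp] at this
  exact LinearMap.congr_fun this x

lemma d_s_self (n : ℕ) (i : Fin (n + 1)) (x : C.ch n) : C.d n i.castSucc (C.s n i x) = x :=
  LinearMap.congr_fun (congrArg ModuleCat.Hom.hom (C.X.δ_comp_σ_self (i := i))) x

lemma d_s_succ (n : ℕ) (i : Fin (n + 1)) (x : C.ch n) : C.d n i.succ (C.s n i x) = x :=
  LinearMap.congr_fun (congrArg ModuleCat.Hom.hom (C.X.δ_comp_σ_succ (i := i))) x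

lemma d_s_mem (n : ℕ) (i : Fin (n + 1)) (j : Fin (n + 2)) (h1 : j ≠ i.castSucc) (h2 : j ≠ i.succ)
    (x : C.ch n) : C.d n j (C.s n i x) ∈ C.degenerate n := by
  obtain _ | n := n
  · exfalso
    fin_cases i; fin_cases j <;> simp_all
  rcases lt_or_gt_of_ne h1 with h | h
  · obtain ⟨i, rfl⟩ := Fin.exists_succ_eq.2 (show i ≠ 0 by
      rintro rfl; exact absurd h (by simp))
    obtain ⟨j, rfl⟩ : ∃ j', j = Fin.castSucc j' := ⟨j.castPred (by
      rintro rfl; exact absurd h (not_lt.2 (Fin.le_last _))), by simp⟩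
    have := C.hom_eq (C.X.δ_comp_σ_of_le (i := j) (j := i) (by
      rw [Fin.lt_def] at h; rw [Fin.le_def]; simp at h ⊢; omega)) x
    exact this ▸ C.s_mem_degenerate _ _ _
  · have h3 : i.succ < j := lt_of_le_of_ne (by
      rw [Fin.lt_def] at h; rw [Fin.le_def]; simp at h ⊢; omega) h2.symm
    obtain ⟨j, rfl⟩ := Fin.exists_succ_eq.2 (show j ≠ 0 by
      rintro rfl; exact absurd h3 (by simp))
    obtain ⟨i, rfl⟩ : ∃ i', i = Fin.castSucc i' := ⟨i.castPred (by
      rintro rfl; exact absurd h3 (not_lt.2 (Fin.le_last _))), by simp⟩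
    have := C.hom_eq (C.X.δ_comp_σ_of_gt (i := j) (j := i) (by
      rw [Fin.lt_def] at h3 ⊢; simp at h3 ⊢; omega)) x
    exact this ▸ C.s_mem_degenerate _ _ _

lemma b_degenerate (n : ℕ) : C.degenerate (n + 1) ≤ (C.degenerate n).comap (C.b n) := by
  refine C.degenerate_le fun i x => ?_
  have hne : i.castSucc ≠ i.succ := (Fin.castSucc_lt_succ).ne
  rw [Submodule.mem_comap, b, LinearMap.sum_apply,
    ← Finset.add_sum_erase _ _ (Finset.mem_univ i.castSucc),
    ← Finset.add_sum_erase _ _ (Finset.mem_erase.2 ⟨hne.symm, Finset.mem_univ i.succ⟩),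
    ← add_assoc]
  refine add_mem ?_ (sum_mem fun j hj => ?_)
  · simp only [LinearMap.smul_apply, d_s_self, d_s_succ, Fin.val_castSucc, Fin.val_succ, pow_succ]
    simp
  · simp only [Finset.mem_erase] at hj
    exact Submodule.smul_mem _ _ (C.d_s_mem n i j hj.2.1 hj.1 x)

lemma τ_τ_s_last (n : ℕ) (x : C.ch n) :
    (C.τ (n + 1)).hom ((C.τ (n + 1)).hom (C.s n (Fin.last n) x)) =
      C.s n 0 ((C.τ n).hom x) :=
  (C.hom_eq (C.τ_σ_zero n) x).symm

/-- The span of the degenerate elements and the image of the extra degeneracy. -/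
def extDegenerate (n : ℕ) : Submodule k (C.ch (n + 1)) :=
  C.degenerate (n + 1) ⊔ LinearMap.range (C.sExtra n)

lemma τ_extDegenerate (n : ℕ) (x : C.ch (n + 1)) (hx : x ∈ C.extDegenerate n) :
    (C.τ (n + 1)).hom x ∈ C.extDegenerate n := by
  suffices h : C.extDegenerate n ≤ (C.extDegenerate n).comap (C.τ (n + 1)).hom from h hx
  refine sup_le (C.degenerate_le fun i y => ?_) ?_
  · rw [Submodule.mem_comap]
    induction i using Fin.lastCases with
    | last => exact Submodule.mem_sup_right (LinearMap.mem_range_self (C.sExtra n) y)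
    | cast i =>
      obtain _ | n := n
      · exact i.elim0
      have := C.hom_eq (C.τ_σ_succ n i) y
      refine Submodule.mem_sup_left ?_
      exact this ▸ C.s_mem_degenerate _ _ _
  · rintro _ ⟨y, rfl⟩
    refine Submodule.mem_sup_left ?_
    exact (C.τ_τ_s_last n y).symm ▸ C.s_mem_degenerate _ _ _

lemma sExtra_extDegenerate (n : ℕ) (x : C.ch (n + 1)) (hx : x ∈ C.extDegenerate n) :
    C.sExtra (n + 1) x ∈ C.degenerate (n + 2) := by
  suffices h : C.extDegenerate n ≤ (C.degenerate (n + 2)).comap (C.sExtra (n + 1)) from h hx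
  have key : ∀ (i : Fin (n + 1)) (y : C.ch n),
      C.s (n + 1) (Fin.last (n + 1)) (C.s n i y) = C.s (n + 1) i.castSucc (C.s n (Fin.last n) y) :=
    fun i y => (C.hom_eq (C.X.σ_comp_σ (i := i) (j := Fin.last n) (Fin.le_last i)) y).symm
  refine sup_le (C.degenerate_le fun i y => ?_) ?_
  · rw [Submodule.mem_comap, sExtra, LinearMap.comp_apply, key]
    have := C.hom_eq (C.τ_σ_succ n i) (C.s n (Fin.last n) y)
    exact this ▸ C.s_mem_degenerate _ _ _
  · rintro _ ⟨y, rfl⟩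
    have h1 : C.s (n + 1) (Fin.last (n + 1)) ((C.τ (n + 1)).hom (C.s n (Fin.last n) y)) =
        (C.τ (n + 2)).hom (C.s (n + 1) (Fin.last n).castSucc (C.s n (Fin.last n) y)) :=
      C.hom_eq (C.τ_σ_succ n (Fin.last n)) (C.s n (Fin.last n) y)
    rw [Submodule.mem_comap, sExtra, LinearMap.comp_apply, sExtra, LinearMap.comp_apply, h1,
      ← key, τ_τ_s_last]
    exact C.s_mem_degenerate _ _ _

lemma t_pow_extDegenerate (n j : ℕ) (x : C.ch (n + 1)) (hx : x ∈ C.extDegenerate n) :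
    (C.t (n + 1) ^ j) x ∈ C.extDegenerate n := by
  induction j with
  | zero => simpa using hx
  | succ j ih =>
    rw [pow_succ', Module.End.mul_apply]
    exact Submodule.smul_mem _ _ (C.τ_extDegenerate n _ ih)

lemma B_degenerate (n : ℕ) : C.degenerate n ≤ (C.degenerate (n + 1)).comap (C.B n) := by
  obtain _ | n := n
  · exact bot_le
  intro x hx
  have h1 : C.N (n + 1) x ∈ C.extDegenerate n := by
    rw [N, LinearMap.sum_apply]
    exact sum_mem fun j _ => C.t_pow_extDegenerate n j x (Submodule.mem_sup_left hx)
  have h2 : C.t (n + 2) (C.sExtra (n + 1) (C.N (n + 1) x)) ∈ C.degenerate (n + 2) := by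
    refine Submodule.smul_mem _ _ ?_
    rw [sExtra, LinearMap.comp_apply, τ_τ_s_last]
    exact C.s_mem_degenerate _ _ _
  exact sub_mem (C.sExtra_extDegenerate n _ h1) h2

/-- The normalized mixed complex `C̄ = C / D` of a cyclic module. -/
def normalizedMixedComplex : MixedComplex.{u, v} k :=
  C.mixedComplex.quotient C.degenerate C.b_degenerate C.B_degenerate

end CyclicModule

/-- A supercomplex: a `ℤ/2`-graded space `V₀ ⊕ V₁` with maps `∂₀ : V₀ → V₁`, `∂₁ : V₁ → V₀` such
that `∂₀ ∂₁ = 0` and `∂₁ ∂₀ = 0`. -/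
structure Supercomplex (k : Type u) [Field k] where
  V₀ : Type v
  V₁ : Type v
  [addCommGroup₀ : AddCommGroup V₀]
  [addCommGroup₁ : AddCommGroup V₁]
  [module₀ : Module k V₀]
  [module₁ : Module k V₁]
  d₀ : V₀ →ₗ[k] V₁
  d₁ : V₁ →ₗ[k] V₀
  d₀_d₁ : ∀ x, d₀ (d₁ x) = 0
  d₁_d₀ : ∀ x, d₁ (d₀ x) = 0

attribute [instance] Supercomplex.addCommGroup₀ Supercomplex.addCommGroup₁
  Supercomplex.module₀ Supercomplex.module₁

namespace Supercomplex

variable {k : Type u} [Field k]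

/-- `H₀ = ker ∂₀ / im ∂₁`. -/
abbrev H₀ (X : Supercomplex.{u, v} k) : Type v :=
  LinearMap.ker X.d₀ ⧸ (LinearMap.range X.d₁).submoduleOf (LinearMap.ker X.d₀)

/-- `H₁ = ker ∂₁ / im ∂₀`. -/
abbrev H₁ (X : Supercomplex.{u, v} k) : Type v :=
  LinearMap.ker X.d₁ ⧸ (LinearMap.range X.d₀).submoduleOf (LinearMap.ker X.d₁)

/-- Maps of supercomplexes. -/
structure Hom (X : Supercomplex.{u, v} k) (Y : Supercomplex.{u, w} k) where
  f₀ : X.V₀ →ₗ[k] Y.V₀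
  f₁ : X.V₁ →ₗ[k] Y.V₁
  comm₀ : ∀ x, Y.d₀ (f₀ x) = f₁ (X.d₀ x)
  comm₁ : ∀ x, Y.d₁ (f₁ x) = f₀ (X.d₁ x)

/-- The map induced on `H₀`. -/
def Hom.mapH₀ {X : Supercomplex.{u, v} k} {Y : Supercomplex.{u, w} k} (f : Hom X Y) :
    X.H₀ →ₗ[k] Y.H₀ :=
  Submodule.mapQ _ _ (f.f₀.restrict fun x hx => by
      rw [LinearMap.mem_ker] at hx ⊢; rw [f.comm₀, hx, map_zero]) (by
    rintro ⟨x, hx⟩ ⟨y, hy⟩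
    exact ⟨f.f₁ y, (f.comm₁ y).trans (congrArg f.f₀ hy)⟩)

/-- The map induced on `H₁`. -/
def Hom.mapH₁ {X : Supercomplex.{u, v} k} {Y : Supercomplex.{u, w} k} (f : Hom X Y) :
    X.H₁ →ₗ[k] Y.H₁ :=
  Submodule.mapQ _ _ (f.f₁.restrict fun x hx => by
      rw [LinearMap.mem_ker] at hx ⊢; rw [f.comm₁, hx, map_zero]) (by
    rintro ⟨x, hx⟩ ⟨y, hy⟩
    exact ⟨f.f₀ y, (f.comm₀ y).trans (congrArg f.f₁ hy)⟩)

variable (X : Supercomplex.{u, v} k) (Y : Supercomplex.{u, w} k)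

/-- The differential `∂₀` of `X ⊗̂ Y`. -/
def tensorD₀ : (X.V₀ ⊗[k] Y.V₀) × (X.V₁ ⊗[k] Y.V₁) →ₗ[k] (X.V₀ ⊗[k] Y.V₁) × (X.V₁ ⊗[k] Y.V₀) :=
  LinearMap.prod
    (LinearMap.coprod (Y.d₀.lTensor X.V₀) (X.d₁.rTensor Y.V₁))
    (LinearMap.coprod (X.d₀.rTensor Y.V₀) (-(Y.d₁.lTensor X.V₁)))

/-- The differential `∂₁` of `X ⊗̂ Y`. -/
def tensorD₁ : (X.V₀ ⊗[k] Y.V₁) × (X.V₁ ⊗[k] Y.V₀) →ₗ[k] (X.V₀ ⊗[k] Y.V₀) × (X.V₁ ⊗[k] Y.V₁) :=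
  LinearMap.prod
    (LinearMap.coprod (Y.d₁.lTensor X.V₀) (X.d₁.rTensor Y.V₀))
    (LinearMap.coprod (X.d₀.rTensor Y.V₁) (-(Y.d₀.lTensor X.V₁)))

lemma tensor_d₀_left (x : X.V₀) (y : Y.V₀) :
    tensorD₀ X Y (x ⊗ₜ y, 0) = (x ⊗ₜ Y.d₀ y, X.d₀ x ⊗ₜ y) := by
  simp [tensorD₀]

lemma tensor_d₀_right (x : X.V₁) (y : Y.V₁) :
    tensorD₀ X Y (0, x ⊗ₜ y) = (X.d₁ x ⊗ₜ y, -(x ⊗ₜ Y.d₁ y)) := by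
  simp [tensorD₀]

lemma tensor_d₁_left (x : X.V₀) (y : Y.V₁) :
    tensorD₁ X Y (x ⊗ₜ y, 0) = (x ⊗ₜ Y.d₁ y, X.d₀ x ⊗ₜ y) := by
  simp [tensorD₁]

lemma tensor_d₁_right (x : X.V₁) (y : Y.V₀) :
    tensorD₁ X Y (0, x ⊗ₜ y) = (X.d₁ x ⊗ₜ y, -(x ⊗ₜ Y.d₀ y)) := by
  simp [tensorD₁]

lemma tensorD₀_comp_tensorD₁ : tensorD₀ X Y ∘ₗ tensorD₁ X Y = 0 := by
  ext x y <;> simp [tensorD₀, tensorD₁, X.d₀_d₁, X.d₁_d₀, Y.d₀_d₁, Y.d₁_d₀]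

lemma tensorD₁_comp_tensorD₀ : tensorD₁ X Y ∘ₗ tensorD₀ X Y = 0 := by
  ext x y <;> simp [tensorD₀, tensorD₁, X.d₀_d₁, X.d₁_d₀, Y.d₀_d₁, Y.d₁_d₀]

/-- The tensor product `X ⊗̂ Y` of supercomplexes:
`(X ⊗̂ Y)₀ = X₀ ⊗ Y₀ ⊕ X₁ ⊗ Y₁` and `(X ⊗̂ Y)₁ = X₀ ⊗ Y₁ ⊕ X₁ ⊗ Y₀`, with the differential
`∂ (x ⊗ y) = ∂ x ⊗ y + (-1)^|x| x ⊗ ∂ y`. -/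
abbrev tensor : Supercomplex.{u, max v w} k where
  V₀ := (X.V₀ ⊗[k] Y.V₀) × (X.V₁ ⊗[k] Y.V₁)
  V₁ := (X.V₀ ⊗[k] Y.V₁) × (X.V₁ ⊗[k] Y.V₀)
  d₀ := tensorD₀ X Y
  d₁ := tensorD₁ X Y
  d₀_d₁ := LinearMap.congr_fun (tensorD₀_comp_tensorD₁ X Y)
  d₁_d₀ := LinearMap.congr_fun (tensorD₁_comp_tensorD₀ X Y)

/-- A bilinear map `f` which sends pairs of cycles to cycles, and a cycle and a boundary to a
boundary, induces a map `ZA/BA ⊗ ZB/BB → ZC/BC`. -/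
def liftHomology {A B C : Type*} [AddCommGroup A] [AddCommGroup B] [AddCommGroup C] [Module k A]
    [Module k B] [Module k C] (ZA BA : Submodule k A) (ZB BB : Submodule k B)
    (ZC BC : Submodule k C) (f : A →ₗ[k] B →ₗ[k] C) (h : ∀ x ∈ ZA, ∀ y ∈ ZB, f x y ∈ ZC)
    (h₁ : ∀ x ∈ BA, ∀ y ∈ ZB, f x y ∈ BC) (h₂ : ∀ x ∈ ZA, ∀ y ∈ BB, f x y ∈ BC) :
    (ZA ⧸ BA.submoduleOf ZA) ⊗[k] (ZB ⧸ BB.submoduleOf ZB) →ₗ[k] ZC ⧸ BC.submoduleOf ZC :=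
  TensorProduct.lift <| (BA.submoduleOf ZA).liftQ
    { toFun := fun x => Submodule.mapQ _ _ ((f x).restrict (h x x.2)) fun y hy => h₂ x x.2 y hy
      map_add' := fun x x' => by
        refine Submodule.linearMap_qext _ (LinearMap.ext fun y => ?_)
        refine congrArg (Submodule.mkQ _) (Subtype.ext ?_)
        simp
      map_smul' := fun c x => by
        refine Submodule.linearMap_qext _ (LinearMap.ext fun y => ?_)
        refine congrArg (Submodule.mkQ _) (Subtype.ext ?_)
        simp }
    fun x hx => by
      refine Submodule.linearMap_qext _ (LinearMap.ext fun y => ?_)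
      exact (Submodule.Quotient.mk_eq_zero _).2 (h₁ x hx y y.2)

/-- `H₀(X) ⊗ H₀(Y) → H₀(X ⊗̂ Y)`, `[x] ⊗ [y] ↦ [x ⊗ y]`. -/
def cross₀₀ : X.H₀ ⊗[k] Y.H₀ →ₗ[k] (X.tensor Y).H₀ :=
  liftHomology _ _ _ _ (LinearMap.ker (X.tensor Y).d₀) (LinearMap.range (X.tensor Y).d₁)
    ((TensorProduct.mk k X.V₀ Y.V₀).compr₂
      (LinearMap.inl k (X.V₀ ⊗[k] Y.V₀) (X.V₁ ⊗[k] Y.V₁)))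
    (fun x hx y hy => by
      rw [LinearMap.mem_ker] at hx hy
      exact (tensor_d₀_left X Y x y).trans (by simp [hx, hy]))
    (by
      rintro _ ⟨x', rfl⟩ y hy
      rw [LinearMap.mem_ker] at hy
      exact ⟨(0, (x') ⊗ₜ[k] (y)), (tensor_d₁_right X Y x' y).trans (by simp [hy])⟩)
    (by
      rintro x hx _ ⟨y', rfl⟩
      rw [LinearMap.mem_ker] at hx
      exact ⟨((x) ⊗ₜ[k] (y'), 0), (tensor_d₁_left X Y (x) y').trans (by
        simp [hx])⟩)

/-- `H₁(X) ⊗ H₁(Y) → H₀(X ⊗̂ Y)`, `[x] ⊗ [y] ↦ [x ⊗ y]`. -/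
def cross₁₁ : X.H₁ ⊗[k] Y.H₁ →ₗ[k] (X.tensor Y).H₀ :=
  liftHomology _ _ _ _ (LinearMap.ker (X.tensor Y).d₀) (LinearMap.range (X.tensor Y).d₁)
    ((TensorProduct.mk k X.V₁ Y.V₁).compr₂
      (LinearMap.inr k (X.V₀ ⊗[k] Y.V₀) (X.V₁ ⊗[k] Y.V₁)))
    (fun x hx y hy => by
      rw [LinearMap.mem_ker] at hx hy
      exact (tensor_d₀_right X Y x y).trans (by simp [hx, hy]))
    (by
      rintro _ ⟨x', rfl⟩ y hy
      rw [LinearMap.mem_ker] at hy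
      exact ⟨((x') ⊗ₜ[k] (y), 0), (tensor_d₁_left X Y x' y).trans (by simp [hy])⟩)
    (by
      rintro x hx _ ⟨y', rfl⟩
      rw [LinearMap.mem_ker] at hx
      exact ⟨(0, (-x) ⊗ₜ[k] (y')), (tensor_d₁_right X Y (-x) y').trans (by
        simp [hx, TensorProduct.neg_tmul, neg_neg])⟩)

/-- `H₀(X) ⊗ H₁(Y) → H₁(X ⊗̂ Y)`, `[x] ⊗ [y] ↦ [x ⊗ y]`. -/
def cross₀₁ : X.H₀ ⊗[k] Y.H₁ →ₗ[k] (X.tensor Y).H₁ :=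
  liftHomology _ _ _ _ (LinearMap.ker (X.tensor Y).d₁) (LinearMap.range (X.tensor Y).d₀)
    ((TensorProduct.mk k X.V₀ Y.V₁).compr₂
      (LinearMap.inl k (X.V₀ ⊗[k] Y.V₁) (X.V₁ ⊗[k] Y.V₀)))
    (fun x hx y hy => by
      rw [LinearMap.mem_ker] at hx hy
      exact (tensor_d₁_left X Y x y).trans (by simp [hx, hy]))
    (by
      rintro _ ⟨x', rfl⟩ y hy
      rw [LinearMap.mem_ker] at hy
      exact ⟨(0, (x') ⊗ₜ[k] (y)), (tensor_d₀_right X Y x' y).trans (by simp [hy])⟩)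
    (by
      rintro x hx _ ⟨y', rfl⟩
      rw [LinearMap.mem_ker] at hx
      exact ⟨((x) ⊗ₜ[k] (y'), 0), (tensor_d₀_left X Y (x) y').trans (by
        simp [hx])⟩)

/-- `H₁(X) ⊗ H₀(Y) → H₁(X ⊗̂ Y)`, `[x] ⊗ [y] ↦ [x ⊗ y]`. -/
def cross₁₀ : X.H₁ ⊗[k] Y.H₀ →ₗ[k] (X.tensor Y).H₁ :=
  liftHomology _ _ _ _ (LinearMap.ker (X.tensor Y).d₁) (LinearMap.range (X.tensor Y).d₀)
    ((TensorProduct.mk k X.V₁ Y.V₀).compr₂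
      (LinearMap.inr k (X.V₀ ⊗[k] Y.V₁) (X.V₁ ⊗[k] Y.V₀)))
    (fun x hx y hy => by
      rw [LinearMap.mem_ker] at hx hy
      exact (tensor_d₁_right X Y x y).trans (by simp [hx, hy]))
    (by
      rintro _ ⟨x', rfl⟩ y hy
      rw [LinearMap.mem_ker] at hy
      exact ⟨((x') ⊗ₜ[k] (y), 0), (tensor_d₀_left X Y x' y).trans (by simp [hy])⟩)
    (by
      rintro x hx _ ⟨y', rfl⟩
      rw [LinearMap.mem_ker] at hx
      exact ⟨(0, (-x) ⊗ₜ[k] (y')), (tensor_d₀_right X Y (-x) y').trans (by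
        simp [hx, TensorProduct.neg_tmul, neg_neg])⟩)

/-- The even part of the canonical map `H(X) ⊗̂ H(Y) → H(X ⊗̂ Y)`. -/
def cross₀ : (X.H₀ ⊗[k] Y.H₀) × (X.H₁ ⊗[k] Y.H₁) →ₗ[k] (X.tensor Y).H₀ :=
  LinearMap.coprod (cross₀₀ X Y) (cross₁₁ X Y)

/-- The odd part of the canonical map `H(X) ⊗̂ H(Y) → H(X ⊗̂ Y)`. -/
def cross₁ : (X.H₀ ⊗[k] Y.H₁) × (X.H₁ ⊗[k] Y.H₀) →ₗ[k] (X.tensor Y).H₁ :=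
  LinearMap.coprod (cross₀₁ X Y) (cross₁₀ X Y)

end Supercomplex

namespace MixedComplex

variable {k : Type u} [Field k] (M : MixedComplex.{u, v} k)

/-- The map `(x_j) ↦ B x_{j-1}` (and `0` for `j = 0`) on families indexed by a set `P` of degrees. -/
def prevB {P : ℕ → Prop} :
    ∀ (j : ℕ), (∀ i, j = i + 1 → P i) → (∀ i : {i // P i}, M.V i) →ₗ[k] M.V j
  | 0, _ => 0
  | j + 1, h => M.B j ∘ₗ LinearMap.proj (⟨j, h j rfl⟩ : {i // P i})

/-- The differential `b + B`, `(x_j)_{j ∈ P} ↦ (b x_{j+1} + B x_{j-1})_{j ∈ Q}`, for sets of degrees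
`P`, `Q` such that `j + 1 ∈ P` for `j ∈ Q` and `j ∈ P` for `j + 1 ∈ Q`. -/
def bB (P Q : ℕ → Prop) (h₁ : ∀ j, Q j → P (j + 1)) (h₂ : ∀ j, Q (j + 1) → P j) :
    (∀ j : {j // P j}, M.V j) →ₗ[k] (∀ j : {j // Q j}, M.V j) :=
  LinearMap.pi fun j =>
    M.b j ∘ₗ LinearMap.proj (⟨j + 1, h₁ j j.2⟩ : {j // P j}) +
      M.prevB j fun i hi => h₂ i (hi ▸ j.2)

lemma bB_apply_zero {P Q : ℕ → Prop} {h₁ h₂} (x : ∀ j : {j // P j}, M.V j) (h : Q 0) :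
    M.bB P Q h₁ h₂ x ⟨0, h⟩ = M.b 0 (x ⟨1, h₁ 0 h⟩) := by
  simp [bB, prevB]

lemma bB_apply_succ {P Q : ℕ → Prop} {h₁ h₂} (x : ∀ j : {j // P j}, M.V j) (j : ℕ)
    (h : Q (j + 1)) :
    M.bB P Q h₁ h₂ x ⟨j + 1, h⟩ = M.b (j + 1) (x ⟨j + 2, h₁ _ h⟩) + M.B j (x ⟨j, h₂ _ h⟩) := by
  simp [bB, prevB]

lemma bB_bB {P Q R : ℕ → Prop} {h₁ h₂ h₃ h₄} (x : ∀ j : {j // P j}, M.V j) :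
    M.bB Q R h₃ h₄ (M.bB P Q h₁ h₂ x) = 0 := by
  have hbb := fun n y => LinearMap.congr_fun (M.b_comp_b n) y
  have hBB := fun n y => LinearMap.congr_fun (M.B_comp_B n) y
  have hbB := fun n y => LinearMap.congr_fun (M.b_comp_B_add n) y
  have hbB0 := fun y => LinearMap.congr_fun M.b_comp_B_zero y
  simp only [LinearMap.comp_apply, LinearMap.zero_apply, LinearMap.add_apply] at hbb hBB hbB hbB0
  funext ⟨j, hj⟩
  match j, hj with
  | 0, hj =>
    rw [bB_apply_zero, bB_apply_succ, map_add, hbb, hbB0, add_zero]; rfl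
  | 1, hj =>
    rw [bB_apply_succ, bB_apply_succ, bB_apply_zero, map_add, hbb, zero_add (M.b (0 + 1) _)]; exact hbB 0 _
  | j + 2, hj =>
    rw [bB_apply_succ, bB_apply_succ, bB_apply_succ, map_add, map_add, hbb, hBB, zero_add,
      add_zero, hbB]; rfl

/-- `Tot_n = M_n ⊕ M_{n-2} ⊕ M_{n-4} ⊕ ⋯`, the degree `n` part of the total complex of the
`(b, B)`-bicomplex. (A finite direct sum, written as a product.) -/
abbrev Tot (n : ℕ) : Type v := ∀ j : {j : ℕ // ∃ i, j + 2 * i = n}, M.V j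

/-- The differential `b + B` of the total complex. -/
def totD (n : ℕ) : M.Tot (n + 1) →ₗ[k] M.Tot n :=
  M.bB _ _ (fun j ⟨i, hi⟩ => ⟨i, by omega⟩) (fun j ⟨i, hi⟩ => ⟨i + 1, by omega⟩)

/-- The cycles of degree `n` in the total complex. -/
def totZ : ∀ n, Submodule k (M.Tot n)
  | 0 => ⊤
  | n + 1 => LinearMap.ker (M.totD n)

/-- Cyclic homology `HC_n`: the homology of the total complex. -/
abbrev HC (n : ℕ) : Type v :=
  M.totZ n ⧸ (LinearMap.range (M.totD n)).submoduleOf (M.totZ n)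

/-- Connes' periodicity map `S : Tot_{n+2} → Tot_n`, which forgets the component in `M_{n+2}`. -/
def totS (n : ℕ) : M.Tot (n + 2) →ₗ[k] M.Tot n :=
  LinearMap.pi fun j => LinearMap.proj
    (⟨j, let ⟨i, hi⟩ := j.2; ⟨i + 1, by omega⟩⟩ : {j : ℕ // ∃ i, j + 2 * i = n + 2})

lemma totD_totS (n : ℕ) (x : M.Tot (n + 3)) :
    M.totD n (M.totS (n + 1) x) = M.totS n (M.totD (n + 2) x) := by
  funext ⟨j, hj⟩
  obtain _ | j := j
  · rfl
  · rfl

lemma totS_mem (n : ℕ) (x : M.Tot (n + 2)) (hx : x ∈ M.totZ (n + 2)) :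
    M.totS n x ∈ M.totZ n := by
  obtain _ | n := n
  · exact Submodule.mem_top
  · have h : M.totD (n + 2) x = 0 := hx
    exact LinearMap.mem_ker.2 ((M.totD_totS n x).trans (by rw [h, map_zero]))

/-- The periodicity map `S : HC_{n+2} → HC_n`. -/
def S (n : ℕ) : M.HC (n + 2) →ₗ[k] M.HC n :=
  Submodule.mapQ _ _ ((M.totS n).restrict (M.totS_mem n)) (by
    rintro ⟨x, hx⟩ ⟨y, hy⟩
    exact ⟨M.totS (n + 1) y, (M.totD_totS n y).trans (congrArg (M.totS n) hy)⟩)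

/-- The degree `n` part `⋯ → HC_{n+4} → HC_{n+2} → HC_n` of the inverse system
`(HC(M)[-2m], S)_m`. -/
def hcTower (n : ℕ) : ℕᵒᵖ ⥤ ModuleCat.{v} k :=
  Functor.ofOpSequence (X := fun m => ModuleCat.of k (M.HC (n + 2 * m)))
    fun m => ModuleCat.ofHom (M.S (n + 2 * m))

/-- The inverse system `(HC(M)[-2m], S)_m` satisfies the Mittag-Leffler condition in each degree:
for every `n` and `j` the images of `S^(i-j) : HC_{n+2i} → HC_{n+2j}` are the same for all
sufficiently large `i`. -/
def IsMittagLeffler : Prop :=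
  ∀ n, (M.hcTower n ⋙ forget (ModuleCat.{v} k)).IsMittagLeffler

/-- The periodic complex `lim Tot = (∏ M_{2n}) ⊕ (∏ M_{2n+1})` with differential `b + B`. -/
def periodic : Supercomplex.{u, v} k where
  V₀ := ∀ j : {j : ℕ // Even j}, M.V j
  V₁ := ∀ j : {j : ℕ // Odd j}, M.V j
  d₀ := M.bB _ _ (fun _ h => h.add_one) (fun _ h => by simpa [Nat.odd_add_one] using h)
  d₁ := M.bB _ _ (fun _ h => h.add_one) (fun _ h => by simpa [Nat.even_add_one] using h)
  d₀_d₁ := M.bB_bB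
  d₁_d₀ := M.bB_bB

/-- Periodic cyclic homology in even degrees. -/
abbrev HP₀ : Type v := M.periodic.H₀

/-- Periodic cyclic homology in odd degrees. -/
abbrev HP₁ : Type v := M.periodic.H₁

end MixedComplex

namespace MixedComplex

variable {k : Type u} [Field k] (M : MixedComplex.{u, v} k) (M' : MixedComplex.{u, w} k)

/-- The degree `n` part `⨁_{p + q = n} M_p ⊗ M'_q` of `M ⊗ M'`. (A finite direct sum, written as a
product.) -/
abbrev tensorV (n : ℕ) : Type (max v w) :=
  ∀ pq : {pq : ℕ × ℕ // pq.1 + pq.2 = n}, M.V pq.1.1 ⊗[k] M'.V pq.1.2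

/-- The differential `b ⊗ 1 + (-1)^p 1 ⊗ b'` of `M ⊗ M'`, `p` being the degree of the left factor. -/
def tensorb (n : ℕ) : M.tensorV M' (n + 1) →ₗ[k] M.tensorV M' n :=
  LinearMap.pi fun pq =>
    (M.b pq.1.1).rTensor (M'.V pq.1.2) ∘ₗ
      LinearMap.proj (⟨(pq.1.1 + 1, pq.1.2), by have := pq.2; dsimp only; omega⟩ :
        {pq : ℕ × ℕ // pq.1 + pq.2 = n + 1}) +
    (-1 : k) ^ pq.1.1 • (M'.b pq.1.2).lTensor (M.V pq.1.1) ∘ₗ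
      LinearMap.proj (⟨(pq.1.1, pq.1.2 + 1), by have := pq.2; dsimp only; omega⟩ :
        {pq : ℕ × ℕ // pq.1 + pq.2 = n + 1})

/-- The component of `B ⊗ 1` in `M_p ⊗ M'_q`. -/
def tensorBleft (n : ℕ) :
    ∀ p q : ℕ, p + q = n + 1 → M.tensorV M' n →ₗ[k] M.V p ⊗[k] M'.V q
  | 0, _, _ => 0
  | p + 1, q, h => (M.B p).rTensor (M'.V q) ∘ₗ
      LinearMap.proj (⟨(p, q), by dsimp only; omega⟩ : {pq : ℕ × ℕ // pq.1 + pq.2 = n})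

/-- The component of `1 ⊗ B'` in `M_p ⊗ M'_q`. -/
def tensorBright (n : ℕ) :
    ∀ p q : ℕ, p + q = n + 1 → M.tensorV M' n →ₗ[k] M.V p ⊗[k] M'.V q
  | _, 0, _ => 0
  | p, q + 1, h => (M'.B q).lTensor (M.V p) ∘ₗ
      LinearMap.proj (⟨(p, q), by dsimp only; omega⟩ : {pq : ℕ × ℕ // pq.1 + pq.2 = n})

/-- The differential `B ⊗ 1 + (-1)^p 1 ⊗ B'` of `M ⊗ M'`. -/
def tensorB (n : ℕ) : M.tensorV M' n →ₗ[k] M.tensorV M' (n + 1) :=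
  LinearMap.pi fun pq => M.tensorBleft M' n pq.1.1 pq.1.2 pq.2 +
    (-1 : k) ^ pq.1.1 • M.tensorBright M' n pq.1.1 pq.1.2 pq.2

lemma tensorb_apply {n : ℕ} (z : M.tensorV M' (n + 1)) (p q : ℕ) (h : p + q = n) :
    M.tensorb M' n z ⟨(p, q), h⟩ =
      (M.b p).rTensor (M'.V q) (z ⟨(p + 1, q), by dsimp only; omega⟩) +
      (-1 : k) ^ p • (M'.b q).lTensor (M.V p) (z ⟨(p, q + 1), by dsimp only; omega⟩) := rfl

lemma tensorB_apply_succ_succ {n : ℕ} (z : M.tensorV M' n) (p q : ℕ)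
    (h : (p + 1) + (q + 1) = n + 1) :
    M.tensorB M' n z ⟨(p + 1, q + 1), h⟩ =
      (M.B p).rTensor (M'.V (q + 1)) (z ⟨(p, q + 1), by dsimp only; omega⟩) +
      (-1 : k) ^ (p + 1) • (M'.B q).lTensor (M.V (p + 1))
        (z ⟨(p + 1, q), by dsimp only; omega⟩) := rfl

lemma tensorB_apply_zero_succ {n : ℕ} (z : M.tensorV M' n) (q : ℕ) (h : 0 + (q + 1) = n + 1) :
    M.tensorB M' n z ⟨(0, q + 1), h⟩ =
      (M'.B q).lTensor (M.V 0) (z ⟨(0, q), by dsimp only; omega⟩) := by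
  simp [tensorB, tensorBleft, tensorBright]

lemma tensorB_apply_succ_zero {n : ℕ} (z : M.tensorV M' n) (p : ℕ) (h : (p + 1) + 0 = n + 1) :
    M.tensorB M' n z ⟨(p + 1, 0), h⟩ =
      (M.B p).rTensor (M'.V 0) (z ⟨(p, 0), by dsimp only; omega⟩) := by
  simp [tensorB, tensorBleft, tensorBright]

section
variable {k A A' A'' E E' E'' : Type*} [Field k]
  [AddCommGroup A] [AddCommGroup A'] [AddCommGroup A'']
  [AddCommGroup E] [AddCommGroup E'] [Module k A] [Module k A'] [Module k A'']
  [Module k E] [Module k E']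

lemma rTensor_zero_of_comp {f : A →ₗ[k] A'} {g : A' →ₗ[k] A''} (h : g ∘ₗ f = 0)
    (z : A ⊗[k] E) : g.rTensor E (f.rTensor E z) = 0 := by
  rw [← LinearMap.rTensor_comp_apply, h, LinearMap.rTensor_zero, LinearMap.zero_apply]

lemma lTensor_zero_of_comp {f : A →ₗ[k] A'} {g : A' →ₗ[k] A''} (h : g ∘ₗ f = 0)
    (z : E ⊗[k] A) : g.lTensor E (f.lTensor E z) = 0 := by
  rw [← LinearMap.lTensor_comp_apply, h, LinearMap.lTensor_zero, LinearMap.zero_apply]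

lemma rTensor_lTensor (f : A →ₗ[k] A') (g : E →ₗ[k] E') (z : A ⊗[k] E) :
    f.rTensor E' (g.lTensor A z) = g.lTensor A' (f.rTensor E z) := by
  rw [← LinearMap.comp_apply, ← LinearMap.comp_apply, LinearMap.rTensor_comp_lTensor,
    LinearMap.lTensor_comp_rTensor]

end

lemma rTensor_bB (E : Type*) [AddCommGroup E] [Module k E] (n : ℕ) (z : M.V (n + 1) ⊗[k] E) :
    (M.b (n + 1)).rTensor E ((M.B (n + 1)).rTensor E z) =
      - (M.B n).rTensor E ((M.b n).rTensor E z) := by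
  rw [← LinearMap.rTensor_comp_apply, ← LinearMap.rTensor_comp_apply,
    eq_neg_of_add_eq_zero_left (M.b_comp_B_add n), LinearMap.rTensor_neg, LinearMap.neg_apply]

lemma lTensor_bB (E : Type*) [AddCommGroup E] [Module k E] (n : ℕ) (z : E ⊗[k] M.V (n + 1)) :
    (M.b (n + 1)).lTensor E ((M.B (n + 1)).lTensor E z) =
      - (M.B n).lTensor E ((M.b n).lTensor E z) := by
  rw [← LinearMap.lTensor_comp_apply, ← LinearMap.lTensor_comp_apply,
    eq_neg_of_add_eq_zero_left (M.b_comp_B_add n), LinearMap.lTensor_neg, LinearMap.neg_apply]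

lemma tensorb_tensorb (n : ℕ) : M.tensorb M' n ∘ₗ M.tensorb M' (n + 1) = 0 := by
  refine LinearMap.ext fun z => funext fun ⟨⟨p, q⟩, h⟩ => ?_
  simp only [LinearMap.comp_apply, tensorb_apply, map_add, map_smul, rTensor_lTensor,
    rTensor_zero_of_comp (M.b_comp_b _), lTensor_zero_of_comp (M'.b_comp_b _), pow_succ,
    LinearMap.zero_apply, Pi.zero_apply]
  module

lemma tensorB_tensorB (n : ℕ) : M.tensorB M' (n + 1) ∘ₗ M.tensorB M' n = 0 := by
  refine LinearMap.ext fun z => funext fun ⟨⟨p, q⟩, h⟩ => ?_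
  rcases p with _ | _ | p <;> rcases q with _ | _ | q <;>
  first
  | (exfalso; dsimp only at h; omega)
  | (simp only [LinearMap.comp_apply, tensorB_apply_succ_succ, tensorB_apply_zero_succ,
      tensorB_apply_succ_zero, map_add, map_smul, rTensor_lTensor, zero_add,
      rTensor_zero_of_comp (M.B_comp_B _), lTensor_zero_of_comp (M'.B_comp_B _), pow_succ,
      LinearMap.zero_apply, Pi.zero_apply]
     try module)

lemma tensorb_tensorB_zero : M.tensorb M' 0 ∘ₗ M.tensorB M' 0 = 0 := by
  refine LinearMap.ext fun z => funext fun ⟨⟨p, q⟩, h⟩ => ?_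
  obtain ⟨rfl, rfl⟩ : p = 0 ∧ q = 0 := by dsimp only at h; omega
  simp [LinearMap.comp_apply, tensorb_apply, tensorB_apply_zero_succ,
      tensorB_apply_succ_zero,
      rTensor_zero_of_comp M.b_comp_B_zero, lTensor_zero_of_comp M'.b_comp_B_zero]

lemma tensorb_tensorB_add (n : ℕ) :
    M.tensorb M' (n + 1) ∘ₗ M.tensorB M' (n + 1) + M.tensorB M' n ∘ₗ M.tensorb M' n = 0 := by
  refine LinearMap.ext fun z => funext fun ⟨⟨p, q⟩, h⟩ => ?_
  rcases p with _ | p <;> rcases q with _ | q <;>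
  first
  | (exfalso; dsimp only at h; omega)
  | (simp only [LinearMap.comp_apply, LinearMap.add_apply, Pi.add_apply, tensorb_apply,
      tensorB_apply_succ_succ, tensorB_apply_zero_succ,
      tensorB_apply_succ_zero, map_add, map_smul, rTensor_lTensor,
      rTensor_zero_of_comp M.b_comp_B_zero, lTensor_zero_of_comp M'.b_comp_B_zero,
      rTensor_bB, lTensor_bB, pow_succ, LinearMap.zero_apply, Pi.zero_apply]
     try module)

/-- The tensor product `M ⊗ M'` of mixed complexes. -/
abbrev tensor : MixedComplex.{u, max v w} k where
  V := M.tensorV M'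
  b := M.tensorb M'
  B := M.tensorB M'
  b_comp_b := M.tensorb_tensorb M'
  B_comp_B := M.tensorB_tensorB M'
  b_comp_B_zero := M.tensorb_tensorB_zero M'
  b_comp_B_add := M.tensorb_tensorB_add M'

open Classical in
/-- Extension by zero of a family indexed by a set `P` of degrees. -/
def extZero (P : ℕ → Prop) : (∀ j : {j // P j}, M.V j) →ₗ[k] (∀ j, M.V j) where
  toFun x j := if h : P j then x ⟨j, h⟩ else 0
  map_add' x y := by funext j; by_cases h : P j <;> simp [h]
  map_smul' c x := by funext j; by_cases h : P j <;> simp [h]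

/-- The pairing `{ξ_p}_{p ∈ P} ⊗ {ξ'_q}_{q ∈ Q} ↦ {∑_{p + q = n} ξ_p ⊗ ξ'_q}_{n ∈ R}`. -/
def pairing (P Q R : ℕ → Prop) :
    (∀ j : {j // P j}, M.V j) →ₗ[k] (∀ j : {j // Q j}, M'.V j) →ₗ[k]
      (∀ n : {n // R n}, M.tensorV M' n) :=
  LinearMap.mk₂ k (fun x y _ pq => M.extZero P x pq.1.1 ⊗ₜ[k] M'.extZero Q y pq.1.2)
    (fun x x' y => by funext n pq; simp [TensorProduct.add_tmul])
    (fun c x y => by funext n pq; simp [TensorProduct.smul_tmul'])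
    (fun x y y' => by funext n pq; simp [TensorProduct.tmul_add])
    (fun c x y => by funext n pq; simp)

lemma pairing_apply {P Q R : ℕ → Prop} (x : ∀ j : {j // P j}, M.V j)
    (y : ∀ j : {j // Q j}, M'.V j) (n : {n // R n}) (pq : {pq : ℕ × ℕ // pq.1 + pq.2 = n}) :
    M.pairing M' P Q R x y n pq = M.extZero P x pq.1.1 ⊗ₜ[k] M'.extZero Q y pq.1.2 := rfl

lemma extZero_bB_zero {P P' : ℕ → Prop} {h₁ h₂} (hP : P 1 → P' 0)
    (x : ∀ j : {j // P j}, M.V j) :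
    M.extZero P' (M.bB P P' h₁ h₂ x) 0 = M.b 0 (M.extZero P x 1) := by
  by_cases h : P' 0
  · simp [extZero, h, h₁ 0 h, bB_apply_zero]
  · have : ¬ P 1 := fun h' => h (hP h')
    simp [extZero, h, this]

lemma extZero_bB_succ {P P' : ℕ → Prop} {h₁ h₂} (j : ℕ) (hP : P (j + 2) → P' (j + 1))
    (hP' : P j → P' (j + 1)) (x : ∀ j : {j // P j}, M.V j) :
    M.extZero P' (M.bB P P' h₁ h₂ x) (j + 1) =
      M.b (j + 1) (M.extZero P x (j + 2)) + M.B j (M.extZero P x j) := by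
  by_cases h : P' (j + 1)
  · have a := h₁ _ h
    have b := h₂ _ h
    simp [extZero, h, a, b, bB_apply_succ]
  · have a : ¬ P (j + 2) := fun h' => h (hP h')
    have b : ¬ P j := fun h' => h (hP' h')
    simp [extZero, h, a, b]

lemma bB_pairing {P P' Q Q' R R' : ℕ → Prop} {h₁ h₂ h₃ h₄ h₅ h₆}
    (hP : ∀ j, P (j + 1) → P' j) (hP' : ∀ j, P j → P' (j + 1))
    (hQ : ∀ j, Q (j + 1) → Q' j) (hQ' : ∀ j, Q j → Q' (j + 1)) (s : k)
    (hs : ∀ j, P j → (-1 : k) ^ j = s)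
    (x : ∀ j : {j // P j}, M.V j) (y : ∀ j : {j // Q j}, M'.V j) :
    (M.tensor M').bB R R' h₅ h₆ (M.pairing M' P Q R x y) =
      M.pairing M' P' Q R' (M.bB P P' h₁ h₂ x) y +
        s • M.pairing M' P Q' R' x (M'.bB Q Q' h₃ h₄ y) := by
  have hsx : ∀ (j q : ℕ) (e : M'.V q),
      (-1 : k) ^ j • (M.extZero P x j ⊗ₜ[k] e) = s • (M.extZero P x j ⊗ₜ[k] e) := by
    intro j q e
    by_cases h : P j
    · rw [hs j h]
    · simp [extZero, h]
  have key : ∀ (n : {n // R' n}) (pq : {pq : ℕ × ℕ // pq.1 + pq.2 = n}),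
      (M.pairing M' P' Q R' (M.bB P P' h₁ h₂ x) y +
        s • M.pairing M' P Q' R' x (M'.bB Q Q' h₃ h₄ y)) n pq =
      M.extZero P' (M.bB P P' h₁ h₂ x) pq.1.1 ⊗ₜ[k] M'.extZero Q y pq.1.2 +
      s • M.extZero P x pq.1.1 ⊗ₜ[k] M'.extZero Q' (M'.bB Q Q' h₃ h₄ y) pq.1.2 := fun _ _ => rfl
  funext ⟨n, hn⟩
  obtain _ | n := n
  · rw [bB_apply_zero]
    funext ⟨⟨p, q⟩, h⟩
    obtain ⟨rfl, rfl⟩ : p = 0 ∧ q = 0 := by dsimp only at h; omega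
    refine Eq.trans ?_ (key ⟨_, hn⟩ ⟨_, h⟩).symm
    refine (M.tensorb_apply M' _ 0 0 h).trans ?_
    rw [pairing_apply, pairing_apply, LinearMap.rTensor_tmul, LinearMap.lTensor_tmul, hsx,
      M.extZero_bB_zero (hP 0), M'.extZero_bB_zero (hQ 0)]
  · rw [bB_apply_succ]
    funext ⟨⟨p, q⟩, h⟩
    refine Eq.trans ?_ (key ⟨_, hn⟩ ⟨_, h⟩).symm
    refine (congrArg₂ (· + ·) (M.tensorb_apply M' _ p q h) rfl).trans ?_
    rcases p with _ | p <;> rcases q with _ | q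
    · exfalso; dsimp only at h; omega
    · refine (congrArg₂ (· + ·) rfl (M.tensorB_apply_zero_succ M' _ q h)).trans ?_
      have := hsx 0 _ (M'.B q (M'.extZero Q y q))
      rw [pow_zero, one_smul] at this
      simp only [pairing_apply, LinearMap.rTensor_tmul, LinearMap.lTensor_tmul, hsx]
      rw [this, M.extZero_bB_zero (hP 0), M'.extZero_bB_succ q (hQ (q + 1)) (hQ' q),
        TensorProduct.tmul_add, smul_add, add_assoc]
    · refine (congrArg₂ (· + ·) rfl (M.tensorB_apply_succ_zero M' _ p h)).trans ?_
      simp only [pairing_apply, LinearMap.rTensor_tmul, LinearMap.lTensor_tmul, hsx]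
      rw [M'.extZero_bB_zero (hQ 0), M.extZero_bB_succ p (hP (p + 1)) (hP' p),
        TensorProduct.add_tmul]
      exact add_right_comm _ _ _
    · refine (congrArg₂ (· + ·) rfl (M.tensorB_apply_succ_succ M' _ p q h)).trans ?_
      simp only [pairing_apply, LinearMap.rTensor_tmul, LinearMap.lTensor_tmul, hsx]
      rw [M'.extZero_bB_succ q (hQ (q + 1)) (hQ' q), M.extZero_bB_succ p (hP (p + 1)) (hP' p),
        TensorProduct.add_tmul, TensorProduct.tmul_add, smul_add]
      exact add_add_add_comm _ _ _ _

lemma odd_of_even_succ (j : ℕ) (h : Even (j + 1)) : Odd j := by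
  rwa [Nat.even_add_one, Nat.not_even_iff_odd] at h

lemma even_of_odd_succ (j : ℕ) (h : Odd (j + 1)) : Even j := by
  rwa [Nat.odd_add_one, Nat.not_odd_iff_even] at h

/-- The even component of `∇` on chains. -/
def nablaChain₀ : (M.periodic.V₀ ⊗[k] M'.periodic.V₀) × (M.periodic.V₁ ⊗[k] M'.periodic.V₁) →ₗ[k]
    (M.tensor M').periodic.V₀ :=
  LinearMap.coprod (TensorProduct.lift (M.pairing M' Even Even Even))
    (TensorProduct.lift (M.pairing M' Odd Odd Even))

/-- The odd component of `∇` on chains. -/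
def nablaChain₁ : (M.periodic.V₀ ⊗[k] M'.periodic.V₁) × (M.periodic.V₁ ⊗[k] M'.periodic.V₀) →ₗ[k]
    (M.tensor M').periodic.V₁ :=
  LinearMap.coprod (TensorProduct.lift (M.pairing M' Even Odd Odd))
    (TensorProduct.lift (M.pairing M' Odd Even Odd))

lemma nablaChain_comm₀ :
    (M.tensor M').periodic.d₀ ∘ₗ M.nablaChain₀ M' =
      M.nablaChain₁ M' ∘ₗ Supercomplex.tensorD₀ M.periodic M'.periodic := by
  refine LinearMap.prod_ext (TensorProduct.ext' fun x y => ?_) (TensorProduct.ext' fun x y => ?_)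
  · have := M.bB_pairing M' (R := Even) (R' := Odd) (h₁ := fun _ h => h.add_one)
      (h₂ := even_of_odd_succ) (h₃ := fun _ h => h.add_one) (h₄ := even_of_odd_succ)
      (h₅ := fun _ h => h.add_one) (h₆ := even_of_odd_succ) odd_of_even_succ
      (fun _ h => h.add_one) odd_of_even_succ (fun _ h => h.add_one) 1
      (fun j h => h.neg_one_pow) x y
    simp only [LinearMap.comp_apply, LinearMap.inl_apply, Supercomplex.tensor_d₀_left]
    simp only [nablaChain₀, nablaChain₁, LinearMap.coprod_apply, map_zero, add_zero]
    rw [one_smul, add_comm] at this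
    exact this
  · have := M.bB_pairing M' (R := Even) (R' := Odd) (h₁ := fun _ h => h.add_one)
      (h₂ := odd_of_even_succ) (h₃ := fun _ h => h.add_one) (h₄ := odd_of_even_succ)
      (h₅ := fun _ h => h.add_one) (h₆ := even_of_odd_succ) even_of_odd_succ
      (fun _ h => h.add_one) even_of_odd_succ (fun _ h => h.add_one) (-1)
      (fun j h => h.neg_one_pow) x y
    simp only [LinearMap.comp_apply, LinearMap.inr_apply, Supercomplex.tensor_d₀_right]
    simp only [nablaChain₀, nablaChain₁, LinearMap.coprod_apply, map_zero, zero_add, map_neg]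
    rw [neg_one_smul] at this
    exact this

lemma nablaChain_comm₁ :
    (M.tensor M').periodic.d₁ ∘ₗ M.nablaChain₁ M' =
      M.nablaChain₀ M' ∘ₗ Supercomplex.tensorD₁ M.periodic M'.periodic := by
  refine LinearMap.prod_ext (TensorProduct.ext' fun x y => ?_) (TensorProduct.ext' fun x y => ?_)
  · have := M.bB_pairing M' (R := Odd) (R' := Even) (h₁ := fun _ h => h.add_one)
      (h₂ := even_of_odd_succ) (h₃ := fun _ h => h.add_one) (h₄ := odd_of_even_succ)
      (h₅ := fun _ h => h.add_one) (h₆ := odd_of_even_succ) odd_of_even_succ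
      (fun _ h => h.add_one) even_of_odd_succ (fun _ h => h.add_one) 1
      (fun j h => h.neg_one_pow) x y
    simp only [LinearMap.comp_apply, LinearMap.inl_apply, Supercomplex.tensor_d₁_left]
    simp only [nablaChain₀, nablaChain₁, LinearMap.coprod_apply, map_zero, add_zero]
    rw [one_smul, add_comm] at this
    exact this
  · have := M.bB_pairing M' (R := Odd) (R' := Even) (h₁ := fun _ h => h.add_one)
      (h₂ := odd_of_even_succ) (h₃ := fun _ h => h.add_one) (h₄ := even_of_odd_succ)
      (h₅ := fun _ h => h.add_one) (h₆ := odd_of_even_succ) even_of_odd_succ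
      (fun _ h => h.add_one) odd_of_even_succ (fun _ h => h.add_one) (-1)
      (fun j h => h.neg_one_pow) x y
    simp only [LinearMap.comp_apply, LinearMap.inr_apply, Supercomplex.tensor_d₁_right]
    simp only [nablaChain₀, nablaChain₁, LinearMap.coprod_apply, map_zero, zero_add, map_neg]
    rw [neg_one_smul] at this
    exact this

/-- The map of supercomplexes `∇ : (lim Tot M) ⊗̂ (lim Tot M') → lim Tot (M ⊗ M')`,
`{ξ_p} ⊗ {ξ'_q} ↦ {∑_{p + q = n} ξ_p ⊗ ξ'_q}_n`. -/
def nabla : Supercomplex.Hom (M.periodic.tensor M'.periodic) (M.tensor M').periodic where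
  f₀ := M.nablaChain₀ M'
  f₁ := M.nablaChain₁ M'
  comm₀ := LinearMap.congr_fun (M.nablaChain_comm₀ M')
  comm₁ := LinearMap.congr_fun (M.nablaChain_comm₁ M')

/-- The even part `HP₀(M) ⊗ HP₀(M') ⊕ HP₁(M) ⊗ HP₁(M') → HP₀(M ⊗ M')` of
`∇ : HP(M) ⊗̂ HP(M') → HP(M ⊗ M')`. -/
def nablaHP₀ :
    (M.HP₀ ⊗[k] M'.HP₀) × (M.HP₁ ⊗[k] M'.HP₁) →ₗ[k] (M.tensor M').HP₀ :=
  (M.nabla M').mapH₀ ∘ₗ Supercomplex.cross₀ M.periodic M'.periodic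

/-- The odd part `HP₀(M) ⊗ HP₁(M') ⊕ HP₁(M) ⊗ HP₀(M') → HP₁(M ⊗ M')` of
`∇ : HP(M) ⊗̂ HP(M') → HP(M ⊗ M')`. -/
def nablaHP₁ :
    (M.HP₀ ⊗[k] M'.HP₁) × (M.HP₁ ⊗[k] M'.HP₀) →ₗ[k] (M.tensor M').HP₁ :=
  (M.nabla M').mapH₁ ∘ₗ Supercomplex.cross₁ M.periodic M'.periodic

end MixedComplex

end

/-! Give `∏ M_n` the product of the discrete topologies: the tails are a basis of neighbourhoods of
`0`, and `D = b + B` (`fullD`) is continuous. The Künneth formula follows once this complex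
contracts, by continuous maps, onto finitely many cycles `z_a` representing bases of `HP₀` and
`HP₁`. Indeed continuous maps can be tensored with the identity on the completed tensor product `∏_n
⨁_{p+q=n} M_p ⊗ M'_q`, which is the complex computing `HP(M ⊗ M')`, and this asks nothing of `M'`.
The two hypotheses produce the contraction.

Mittag-Leffler: a class in `HC_n` is represented by a family `x` with `D x` vanishing below degree
`n`, and `S` keeps the representative. Stabilization of the images therefore says that a good enough
approximate cycle can be changed, only far out, into one that is as good as desired
(`exists_approx`); a limit of such changes is a true cycle (`exists_cycle_of_approx`). Hence a
boundary close to `0` is the boundary of something close to `0`: `D` is open onto its image.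
Successive approximation then gives a continuous `s` with `D s D = D`
(`exists_cont_generalizedInverse`), and `s` can be made odd.

Finiteness: `p = 1 - D s - s D` takes values in cycles, kills boundaries and preserves classes of
cycles. The boundaries are the kernel of the continuous map `1 - D s`, so `x ↦ [p x]` has a closed
kernel of finite codimension, which is open (`finDep_of_finiteDimensional`). The coordinates `φ_a`
in `HP(M)` are thus continuous forms, and after a correction of `s` one gets `x = ∑ φ_a(x) z_a + D s
x + s D x` (`FiniteContraction`).

Tensoring: `w = ∑ z_a ⊠ (φ_a ⊗ 1) w + D (s ⊗ 1) w + (s ⊗ 1) D w` (`tensor_contraction`), by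
continuity from the case of an exterior product. Since `φ_a ⊗ 1` commutes with `D` up to sign, a
cycle `w` is homologous to `∑ z_a ⊠ y_a` with cycles `y_a`, so `∇` is surjective; and if `∑ z_a ⊠
y_a` is a boundary, `φ_a ⊗ 1` shows that each `y_a` is one, so `∇` is injective. -/

noncomputable section

/-! ### Products of vector spaces with the product topology

A linear map out of `∀ n, V n` is continuous for the product of the discrete topologies iff it
vanishes on families whose first components are zero. -/

namespace ProductSpace

variable {k : Type*} [Field k] {V W : ℕ → Type*} {A E : Type*}
  [∀ n, AddCommGroup (V n)] [∀ n, Module k (V n)] [∀ n, AddCommGroup (W n)] [∀ n, Module k (W n)]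
  [AddCommGroup A] [Module k A] [AddCommGroup E] [Module k E]

variable (k V) in
/-- The families whose components of index `< m` vanish. -/
def tail (m : ℕ) : Submodule k (∀ n, V n) where
  carrier := {x | ∀ j < m, x j = 0}
  add_mem' hx hy j hj := by simp [hx j hj, hy j hj]
  zero_mem' _ _ := rfl
  smul_mem' c x hx j hj := by simp [hx j hj]

lemma tail_anti {m n : ℕ} (h : m ≤ n) : tail k V n ≤ tail k V m :=
  fun _ hx j hj => hx j (hj.trans_le h)

lemma tail_zero (x : ∀ n, V n) : x ∈ tail k V 0 := fun _ hj => absurd hj (Nat.not_lt_zero _)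

/-- Continuity of a linear map from a product to a discrete space. -/
def FinDep (f : (∀ n, V n) →ₗ[k] A) : Prop := ∃ m, ∀ x ∈ tail k V m, f x = 0

/-- Continuity of a linear map between products. -/
def Cont (f : (∀ n, V n) →ₗ[k] (∀ n, W n)) : Prop := ∀ j, FinDep (LinearMap.proj j ∘ₗ f)

namespace FinDep

lemma proj (j : ℕ) : FinDep (LinearMap.proj j : (∀ n, V n) →ₗ[k] V j) :=
  ⟨j + 1, fun _ hx => hx j j.lt_succ_self⟩

lemma zero : FinDep (0 : (∀ n, V n) →ₗ[k] A) := ⟨0, fun _ _ => rfl⟩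

lemma add {f g : (∀ n, V n) →ₗ[k] A} (hf : FinDep f) (hg : FinDep g) : FinDep (f + g) := by
  obtain ⟨m, hm⟩ := hf
  obtain ⟨n, hn⟩ := hg
  exact ⟨max m n, fun x hx => by
    simp [hm x (tail_anti (le_max_left _ _) hx), hn x (tail_anti (le_max_right _ _) hx)]⟩

lemma comp_left {f : (∀ n, V n) →ₗ[k] A} (hf : FinDep f) (g : A →ₗ[k] E) : FinDep (g ∘ₗ f) := by
  obtain ⟨m, hm⟩ := hf
  exact ⟨m, fun x hx => by simp [hm x hx]⟩

lemma sum {ι : Type*} (s : Finset ι) {f : ι → (∀ n, V n) →ₗ[k] A} (hf : ∀ i ∈ s, FinDep (f i)) :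
    FinDep (∑ i ∈ s, f i) := by
  classical
  induction s using Finset.induction_on with
  | empty => exact zero
  | insert i s hi ih =>
    rw [Finset.sum_insert hi]
    exact (hf i (Finset.mem_insert_self _ _)).add
      (ih fun j hj => hf j (Finset.mem_insert_of_mem hj))

lemma comp {f : (∀ n, W n) →ₗ[k] A} (hf : FinDep f) {g : (∀ n, V n) →ₗ[k] (∀ n, W n)}
    (hg : Cont g) : FinDep (f ∘ₗ g) := by
  obtain ⟨m, hm⟩ := hf
  choose N hN using hg
  refine ⟨(Finset.range m).sup N, fun x hx => hm _ fun j hj => hN j x ?_⟩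
  exact tail_anti (Finset.le_sup (Finset.mem_range.2 hj)) hx

/-- A continuous linear map is determined by its values on families concentrated in one index. -/
lemma eq_zero {f : (∀ n, V n) →ₗ[k] A} (hf : FinDep f) (h : ∀ j v, f (Pi.single j v) = 0) :
    f = 0 := by
  obtain ⟨m, hm⟩ := hf
  refine LinearMap.ext fun x => ?_
  have hx : x - ∑ j ∈ Finset.range m, Pi.single j (x j) ∈ tail k V m := by
    intro j hj
    rw [Pi.sub_apply, Finset.sum_apply, Finset.sum_eq_single_of_mem j (Finset.mem_range.2 hj)]
    · simp
    · intro i _ hij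
      rw [Pi.single_eq_of_ne hij.symm]
  have := hm _ hx
  rw [map_sub, map_sum, Finset.sum_eq_zero fun j _ => h j _, sub_zero] at this
  exact this

end FinDep

namespace Cont

lemma id : Cont (LinearMap.id : (∀ n, V n) →ₗ[k] (∀ n, V n)) := fun j => FinDep.proj j

lemma add {f g : (∀ n, V n) →ₗ[k] (∀ n, W n)} (hf : Cont f) (hg : Cont g) : Cont (f + g) :=
  fun j => by rw [LinearMap.comp_add]; exact (hf j).add (hg j)

lemma smul {f : (∀ n, V n) →ₗ[k] (∀ n, W n)} (hf : Cont f) (c : k) : Cont (c • f) :=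
  fun j => by
    obtain ⟨m, hm⟩ := hf j
    exact ⟨m, fun x hx => by simpa using Or.inr (hm x hx)⟩

lemma sub {f g : (∀ n, V n) →ₗ[k] (∀ n, W n)} (hf : Cont f) (hg : Cont g) : Cont (f - g) := by
  rw [sub_eq_add_neg, ← neg_one_smul k g]
  exact hf.add (hg.smul _)

lemma sum {ι : Type*} (s : Finset ι) {f : ι → (∀ n, V n) →ₗ[k] (∀ n, W n)}
    (hf : ∀ i ∈ s, Cont (f i)) : Cont (∑ i ∈ s, f i) := by
  intro j
  rw [CyclicModule.comp_finsetSum]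
  exact FinDep.sum s fun i hi => hf i hi j

lemma comp {U : ℕ → Type*} [∀ n, AddCommGroup (U n)] [∀ n, Module k (U n)]
    {f : (∀ n, V n) →ₗ[k] (∀ n, W n)} (hf : Cont f) {g : (∀ n, U n) →ₗ[k] (∀ n, V n)}
    (hg : Cont g) : Cont (f ∘ₗ g) :=
  fun j => (hf j).comp hg

lemma smulRight {φ : (∀ n, V n) →ₗ[k] k} (hφ : FinDep φ) (z : ∀ n, W n) :
    Cont (φ.smulRight z) := by
  obtain ⟨m, hm⟩ := hφ
  exact fun j => ⟨m, fun x hx => by simp [hm x hx]⟩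

end Cont

/-- The sum of a family of vectors in smaller and smaller tails. -/
def tailSum (g : ℕ → ((∀ n, V n) →ₗ[k] (∀ n, W n))) : (∀ n, V n) →ₗ[k] (∀ n, W n) :=
  LinearMap.pi fun j => ∑ i ∈ Finset.range (j + 1), LinearMap.proj j ∘ₗ g i

/-- At a coordinate `j < n` the two finite sums differ by the terms with `j < i < n`, and these
vanish at `j` because `g i x` lies in the tail `i`. -/
lemma tailSum_sub_mem {g : ℕ → ((∀ n, V n) →ₗ[k] (∀ n, W n))} (hg : ∀ i x, g i x ∈ tail k W i)
    (n : ℕ) (x : ∀ n, V n) : tailSum g x - ∑ i ∈ Finset.range n, g i x ∈ tail k W n := by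
  intro j hj
  have : tailSum g x j = ∑ i ∈ Finset.range (j + 1), g i x j := by
    simp [tailSum, LinearMap.sum_apply]
  rw [Pi.sub_apply, this, Finset.sum_apply, sub_eq_zero]
  refine Finset.sum_subset (Finset.range_mono hj) fun i _ hi => hg i x j ?_
  simpa [Nat.lt_succ_iff] using hi

lemma Cont.tailSum {g : ℕ → ((∀ n, V n) →ₗ[k] (∀ n, W n))} (hg : ∀ i, Cont (g i)) :
    Cont (tailSum g) := by
  intro j
  rw [ProductSpace.tailSum, LinearMap.proj_pi]
  exact FinDep.sum _ fun i _ => hg i j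

/-- Over a field, the surjection onto the range has a linear section, which extends from the range
to the whole target. -/
lemma exists_generalizedInverse (f : A →ₗ[k] E) : ∃ g : E →ₗ[k] A, ∀ x, f (g (f x)) = f x := by
  obtain ⟨s, hs⟩ := f.rangeRestrict.exists_rightInverse_of_surjective f.range_rangeRestrict
  obtain ⟨g, hg⟩ := s.exists_extend
  refine ⟨g, fun x => ?_⟩
  have h1 := LinearMap.congr_fun hg (f.rangeRestrict x)
  have h2 := congrArg Subtype.val (LinearMap.congr_fun hs (f.rangeRestrict x))
  simp only [LinearMap.comp_apply] at h1 h2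
  rw [← h1] at h2
  exact h2

/-- One round of successive approximation: `g` solves `D g x = x` modulo the tail `l'` for
boundaries `x` in the tail `l`, with solutions in the tail `i`. It is a generalized inverse of the
map induced by `D` into the quotient by the tail `l'`; factoring through that quotient makes it
continuous. -/
lemma exists_partial_inverse (D : (∀ n, V n) →ₗ[k] (∀ n, V n)) {i l : ℕ} (l' : ℕ)
    (h : ∀ y, D y ∈ tail k V l → ∃ y' ∈ tail k V i, D y' = D y) :
    ∃ g : (∀ n, V n) →ₗ[k] (∀ n, V n), (∀ x, g x ∈ tail k V i) ∧ (∀ x ∈ tail k V l', g x = 0) ∧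
      ∀ y, D y ∈ tail k V l → D y - D (g (D y)) ∈ tail k V l' := by
  let K : Submodule k (∀ n, V n) := tail k V i ⊓ (tail k V l).comap D
  let ψ : K →ₗ[k] (∀ n, V n) ⧸ tail k V l' := (tail k V l').mkQ ∘ₗ D ∘ₗ K.subtype
  obtain ⟨σ, hσ⟩ := exists_generalizedInverse ψ
  refine ⟨K.subtype ∘ₗ σ ∘ₗ (tail k V l').mkQ, fun x => ?_, fun x hx => ?_, fun y hy => ?_⟩
  · exact (σ ((tail k V l').mkQ x)).2.1
  · have : (tail k V l').mkQ x = 0 := (Submodule.Quotient.mk_eq_zero _).2 hx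
    simp only [LinearMap.comp_apply, this, map_zero]
  -- The preimage `y'` lies in `K`, so the class of `D y` is in the range of `ψ`, where `ψ ∘ σ` is
  -- the identity.
  · obtain ⟨y', hy', e⟩ := h y hy
    have := hσ ⟨y', hy', by
      rw [SetLike.mem_coe, Submodule.mem_comap, e]; exact hy⟩
    rw [← Submodule.Quotient.eq, ← e]
    exact this.symm

/-- An open continuous linear map has a continuous generalized inverse. -/
theorem exists_cont_generalizedInverse {D : (∀ n, V n) →ₗ[k] (∀ n, V n)} (hD : Cont D)
    (h : ∀ i, ∃ l, ∀ y, D y ∈ tail k V l → ∃ y' ∈ tail k V i, D y' = D y) :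
    ∃ s : (∀ n, V n) →ₗ[k] (∀ n, V n), Cont s ∧ ∀ y, D (s (D y)) = D y := by
  choose l₀ hl₀ using h
  -- `l 0 = 0` lets every boundary enter round `0`; `i ≤ l i` forces the errors to tend to zero.
  let l : ℕ → ℕ := fun i => if i = 0 then 0 else max (l₀ i) i
  have hle : ∀ i, i ≤ l i := by
    intro i
    by_cases hi : i = 0 <;> simp [l, hi]
  have hl : ∀ i y, D y ∈ tail k V (l i) → ∃ y' ∈ tail k V i, D y' = D y := by
    intro i y hy
    by_cases hi : i = 0
    · subst hi; exact ⟨y, tail_zero y, rfl⟩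
    · refine hl₀ i y (tail_anti ?_ hy)
      simp [l, hi]
  choose g hg₁ hg₂ hg₃ using fun i => exists_partial_inverse D (l (i + 1)) (hl i)
  have hgc : ∀ i, Cont (g i) := fun i j => ⟨l (i + 1), fun x hx => by simp [hg₂ i x hx]⟩
  -- `p i x` is the error left after `i` rounds, `x - D (∑_{r<i} g_r (p_r x))`. On a boundary it
  -- remains a boundary and lies in the tail `l i`, which is what round `i` needs.
  let p : ℕ → ((∀ n, V n) →ₗ[k] (∀ n, V n)) :=
    fun n => Nat.rec LinearMap.id (fun i q => q - D ∘ₗ g i ∘ₗ q) n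
  have hp : ∀ i, p (i + 1) = p i - D ∘ₗ g i ∘ₗ p i := fun i => rfl
  have hpc : ∀ i, Cont (p i) := by
    intro i
    induction i with
    | zero => exact Cont.id
    | succ i ih => rw [hp]; exact ih.sub (hD.comp ((hgc i).comp ih))
  have hpB : ∀ i y, p i (D y) ∈ tail k V (l i) ∧ ∃ y', p i (D y) = D y' := by
    intro i y
    induction i with
    | zero => exact ⟨tail_zero _, y, rfl⟩
    | succ i ih =>
      obtain ⟨h1, y', h2⟩ := ih
      refine ⟨?_, y' - g i (p i (D y)), ?_⟩
      · have := hg₃ i y' (h2 ▸ h1)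
        rw [← h2] at this
        exact this
      · rw [hp, map_sub, ← h2]; rfl
  have hsum : ∀ n x, x - D (∑ i ∈ Finset.range n, g i (p i x)) = p n x := by
    intro n x
    induction n with
    | zero => simp [p]
    | succ n ih =>
      rw [Finset.sum_range_succ, map_add, ← sub_sub, ih, hp]; rfl
  refine ⟨tailSum fun i => g i ∘ₗ p i, Cont.tailSum fun i => (hgc i).comp (hpc i), fun y => ?_⟩
  funext j
  obtain ⟨N, hN⟩ := hD j
  -- The bound `N` makes coordinate `j` of `D` blind to the terms of the series beyond `n`; `j + 1`
  -- makes the error `p n (D y)` vanish at `j`.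
  let n := max N (j + 1)
  have h1 := hN _ (tail_anti (le_max_left N (j + 1))
    (tailSum_sub_mem (g := fun i => g i ∘ₗ p i) (fun i x => hg₁ i _) n (D y)))
  have h2 := congrFun (hsum n (D y)) j
  have h3 := (hpB n y).1 j (by have := hle n; omega)
  simp only [LinearMap.comp_apply, LinearMap.proj_apply, map_sub, Pi.sub_apply] at h1 h2
  rw [h3, sub_eq_zero] at h2
  rw [sub_eq_zero] at h1
  exact h1.trans h2.symm

/-- If cycles can be approximated starting from any approximate cycle, then from any approximate
cycle one finds a true one. -/
theorem exists_cycle_of_approx {D : (∀ n, V n) →ₗ[k] (∀ n, V n)} (hD : Cont D)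
    (h : ∀ j, ∃ n, ∀ n' y, D y ∈ tail k V n →
      ∃ y', D y' ∈ tail k V n' ∧ y' - y ∈ tail k V j) (j : ℕ) :
    ∃ n, ∀ y, D y ∈ tail k V n → ∃ z, D z = 0 ∧ y - z ∈ tail k V j := by
  choose N hN using h
  refine ⟨N j, fun y hy => ?_⟩
  -- The precision asked of the next approximation is `N (j + (i + 1))`, so that the iteration can
  -- go on, and also `i`, so that the differentials tend to zero.
  choose F hF₁ hF₂ using fun (i : ℕ) (y : {y // D y ∈ tail k V (N (j + i))}) =>
    hN (j + i) (max (N (j + (i + 1))) i) y.1 y.2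
  let s : ∀ i, {y // D y ∈ tail k V (N (j + i))} := fun i =>
    Nat.rec ⟨y, hy⟩ (fun i y => ⟨F i y, tail_anti (le_max_left _ _) (hF₁ i y)⟩) i
  have hs : ∀ i, (s (i + 1)).1 - (s i).1 ∈ tail k V (j + i) := fun i => hF₂ i (s i)
  have hsD : ∀ i, D (s (i + 1)).1 ∈ tail k V i :=
    fun i => tail_anti (le_max_right _ _) (hF₁ i (s i))
  have hs' : ∀ i d, (s (i + d)).1 - (s i).1 ∈ tail k V (j + i) := by
    intro i d
    induction d with
    | zero => simp
    | succ d ih =>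
      have := add_mem (tail_anti (by omega) (hs (i + d))) ih
      rwa [sub_add_sub_cancel] at this
  -- Coordinate `n` of the sequence is constant from index `n + 1` on, so this is its limit.
  let z : ∀ n, V n := fun n => (s (n + 1)).1 n
  have hz : ∀ i, z - (s i).1 ∈ tail k V i := by
    intro i n hn
    have := hs' (n + 1) (i - (n + 1)) n (by omega)
    rw [Nat.add_sub_cancel' hn, Pi.sub_apply, sub_eq_zero] at this
    simp [z, this]
  refine ⟨z, ?_, ?_⟩
  · funext n
    obtain ⟨m, hm⟩ := hD n
    have h1 := hm _ (tail_anti (show m ≤ max m (n + 1) + 1 by omega) (hz (max m (n + 1) + 1)))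
    have h2 := hsD (max m (n + 1)) n (by omega)
    simp only [LinearMap.comp_apply, LinearMap.proj_apply, map_sub] at h1
    rw [h2, sub_zero] at h1
    exact h1
  · intro n hn
    have := hs' 0 (n + 1) n (by omega)
    rw [Pi.sub_apply, sub_eq_zero, Nat.zero_add] at this
    simp only [Pi.sub_apply, z, this]
    exact sub_self _

end ProductSpace

/-! ### The product of all degrees as one complex, and its parity decomposition. -/

namespace MixedComplex

open ProductSpace

variable {k : Type u} [Field k] (M : MixedComplex.{u, v} k)

/-- The product of all the components of a mixed complex. -/
abbrev Full : Type v := ∀ n, M.V n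

/-- The differential `b + B` on the product of all components. -/
def fullD : M.Full →ₗ[k] M.Full :=
  LinearMap.pi fun
    | 0 => M.b 0 ∘ₗ LinearMap.proj 1
    | n + 1 => M.b (n + 1) ∘ₗ LinearMap.proj (n + 2) + M.B n ∘ₗ LinearMap.proj n

lemma fullD_zero (x : M.Full) : M.fullD x 0 = M.b 0 (x 1) := rfl

lemma fullD_succ (x : M.Full) (n : ℕ) :
    M.fullD x (n + 1) = M.b (n + 1) (x (n + 2)) + M.B n (x n) := rfl

/-- Restriction of a family to a set of degrees. -/
def res (P : ℕ → Prop) : M.Full →ₗ[k] (∀ j : {j // P j}, M.V j) :=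
  LinearMap.pi fun j => LinearMap.proj j.1

lemma extZero_apply_of {P : ℕ → Prop} (x : ∀ j : {j // P j}, M.V j) {j : ℕ} (h : P j) :
    M.extZero P x j = x ⟨j, h⟩ := by simp [extZero, h]

lemma extZero_apply_of_not {P : ℕ → Prop} (x : ∀ j : {j // P j}, M.V j) {j : ℕ} (h : ¬ P j) :
    M.extZero P x j = 0 := by simp [extZero, h]

lemma res_extZero {P : ℕ → Prop} (x : ∀ j : {j // P j}, M.V j) : M.res P (M.extZero P x) = x :=
  funext fun j => M.extZero_apply_of x j.2

lemma res_fullD {P Q : ℕ → Prop} {h₁ h₂} (x : M.Full) :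
    M.res Q (M.fullD x) = M.bB P Q h₁ h₂ (M.res P x) := by
  funext ⟨j, hj⟩
  obtain _ | j := j
  · rw [bB_apply_zero]; rfl
  · rw [bB_apply_succ]; rfl

lemma fullD_extZero {P Q : ℕ → Prop} {h₁ h₂} (hP : ∀ j, P (j + 1) → Q j)
    (hP' : ∀ j, P j → Q (j + 1)) (x : ∀ j : {j // P j}, M.V j) :
    M.fullD (M.extZero P x) = M.extZero Q (M.bB P Q h₁ h₂ x) := by
  funext j
  obtain _ | j := j
  · rw [M.extZero_bB_zero (hP 0)]; rfl
  · rw [M.extZero_bB_succ j (hP _) (hP' _)]; rfl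

lemma fullD_fullD (x : M.Full) : M.fullD (M.fullD x) = 0 := by
  have h := M.bB_bB (P := fun _ => True) (Q := fun _ => True) (R := fun _ => True)
    (h₁ := fun _ _ => trivial) (h₂ := fun _ _ => trivial) (h₃ := fun _ _ => trivial)
    (h₄ := fun _ _ => trivial) (M.res _ x)
  rw [← res_fullD, ← res_fullD] at h
  funext j
  exact congrFun h ⟨j, trivial⟩

lemma cont_fullD : Cont M.fullD := by
  intro j
  obtain _ | j := j
  · exact (FinDep.proj 1).comp_left (M.b 0)
  · exact ((FinDep.proj (j + 2)).comp_left (M.b (j + 1))).add ((FinDep.proj j).comp_left (M.B j))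

/-- The part of a family in degrees satisfying `P`. -/
def part (P : ℕ → Prop) : M.Full →ₗ[k] M.Full := M.extZero P ∘ₗ M.res P

lemma part_apply_of {P : ℕ → Prop} (x : M.Full) {j : ℕ} (h : P j) : M.part P x j = x j :=
  M.extZero_apply_of _ h

lemma part_apply_of_not {P : ℕ → Prop} (x : M.Full) {j : ℕ} (h : ¬ P j) : M.part P x j = 0 :=
  M.extZero_apply_of_not _ h

lemma cont_part (P : ℕ → Prop) : Cont (M.part P) := fun j => ⟨j + 1, fun x hx => by
  by_cases h : P j
  · simpa [M.part_apply_of x h] using hx j j.lt_succ_self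
  · simp [M.part_apply_of_not x h]⟩

lemma part_even_add_odd (x : M.Full) : M.part Even x + M.part Odd x = x := by
  funext j
  rcases Nat.even_or_odd j with h | h
  · simp [M.part_apply_of x h, M.part_apply_of_not (P := Odd) x (Nat.not_odd_iff_even.2 h)]
  · simp [M.part_apply_of x h, M.part_apply_of_not (P := Even) x (Nat.not_even_iff_odd.2 h)]

lemma fullD_part_even (x : M.Full) : M.fullD (M.part Even x) = M.part Odd (M.fullD x) := by
  have h₁ : ∀ j, Odd j → Even (j + 1) := fun _ h => h.add_one
  rw [part, LinearMap.comp_apply, M.fullD_extZero (h₁ := h₁) (h₂ := even_of_odd_succ)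
    odd_of_even_succ (fun _ h => h.add_one), ← res_fullD]
  rfl

lemma fullD_part_odd (x : M.Full) : M.fullD (M.part Odd x) = M.part Even (M.fullD x) := by
  have h₁ : ∀ j, Even j → Odd (j + 1) := fun _ h => h.add_one
  rw [part, LinearMap.comp_apply, M.fullD_extZero (h₁ := h₁) (h₂ := odd_of_even_succ)
    even_of_odd_succ (fun _ h => h.add_one), ← res_fullD]
  rfl

/-! ### The Mittag-Leffler condition on chains -/

/-- The degrees occurring in `Tot_n`. -/
abbrev TotDeg (n j : ℕ) : Prop := ∃ i, j + 2 * i = n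

lemma totD_res (n : ℕ) (x : M.Full) :
    M.totD n (M.res (TotDeg (n + 1)) x) = M.res (TotDeg n) (M.fullD x) :=
  (M.res_fullD x).symm

/-- The differential of `Tot_n` sees only components of `fullD x` in degrees below `n`. -/
lemma res_mem_totZ {n m : ℕ} (h : n ≤ m) {x : M.Full} (hx : M.fullD x ∈ tail k M.V m) :
    M.res (TotDeg n) x ∈ M.totZ n := by
  obtain _ | n := n
  · exact Submodule.mem_top
  · refine LinearMap.mem_ker.2 ((M.totD_res n x).trans ?_)
    funext ⟨j, i, hi⟩
    exact hx j (by omega)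

/-- Below degree `n`, the components of the parity of `n - 1` vanish by the cycle condition. The
others vanish since the neighbouring entries of the extension are zero. Thus cycles of `Tot_n` are
truncations of approximate cycles. -/
lemma fullD_extZero_mem_tail {n : ℕ} {x : M.Tot n} (hx : x ∈ M.totZ n) :
    M.fullD (M.extZero (TotDeg n) x) ∈ tail k M.V n := by
  obtain _ | n := n
  · exact tail_zero _
  intro j hj
  by_cases hd : TotDeg n j
  · have h : M.totD n x = 0 := hx
    rw [← M.res_extZero x, totD_res] at h
    exact congrFun h ⟨j, hd⟩
  · have h1 : ∀ i, j + 2 * i ≠ n := fun i hi => hd ⟨i, hi⟩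
    obtain _ | j := j
    · rw [fullD_zero, M.extZero_apply_of_not, map_zero]
      rintro ⟨i, hi⟩
      exact h1 i (by omega)
    · rw [fullD_succ, M.extZero_apply_of_not, M.extZero_apply_of_not, map_zero, map_zero, add_zero]
      · rintro ⟨i, hi⟩
        exact h1 (i - 1) (by omega)
      · rintro ⟨i, hi⟩
        exact h1 i (by omega)

/-- The class in `HC_n` of an approximate cycle. -/
def hcMk {n m : ℕ} (h : n ≤ m) (x : M.Full) (hx : M.fullD x ∈ tail k M.V m) : M.HC n :=
  Submodule.Quotient.mk ⟨M.res (TotDeg n) x, M.res_mem_totZ h hx⟩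

/-- Periodicity keeps the representing family and only reads fewer of its components. This is what
turns a condition on the tower of `HC` groups into one on families. -/
lemma S_hcMk {n m : ℕ} (h : n + 2 ≤ m) (x : M.Full) (hx : M.fullD x ∈ tail k M.V m) :
    M.S n (M.hcMk h x hx) = M.hcMk (by omega) x hx := rfl

lemma exists_hcMk {n : ℕ} (c : M.HC n) :
    ∃ (x : M.Full) (hx : M.fullD x ∈ tail k M.V n), M.hcMk le_rfl x hx = c := by
  obtain ⟨⟨x, hx⟩, rfl⟩ := Submodule.Quotient.mk_surjective _ c
  refine ⟨_, M.fullD_extZero_mem_tail hx, ?_⟩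
  exact congrArg Submodule.Quotient.mk (Subtype.ext (M.res_extZero x))

lemma exists_fullD_of_hcMk_eq {n m m' : ℕ} (h : n ≤ m) (h' : n ≤ m') {x y : M.Full}
    (hx : M.fullD x ∈ tail k M.V m) (hy : M.fullD y ∈ tail k M.V m')
    (e : M.hcMk h x hx = M.hcMk h' y hy) :
    ∃ w : M.Full, ∀ j, TotDeg n j → (x - y - M.fullD w) j = 0 := by
  obtain ⟨w, hw⟩ := (Submodule.Quotient.eq _).1 e
  refine ⟨M.extZero _ w, fun j hj => ?_⟩
  have := congrFun ((M.totD_res n (M.extZero _ w)).symm.trans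
    ((congrArg (M.totD n) (M.res_extZero w)).trans hw)) ⟨j, hj⟩
  rw [Pi.sub_apply, sub_eq_zero]
  exact this.symm

/-- Iterating `S_hcMk`: arrows of `ℕᵒᵖ` are unique, so each transition map splits off one `S` at a
time. -/
lemma hcTower_map_hcMk (n m : ℕ) (f : Opposite.op m ⟶ Opposite.op 0) (x : M.Full)
    (hx : M.fullD x ∈ tail k M.V (n + 2 * m)) :
    (M.hcTower n).map f (M.hcMk le_rfl x hx : M.HC (n + 2 * m)) =
      (M.hcMk (by omega) x hx : M.HC (n + 2 * 0)) := by
  suffices h : ∀ (l : ℕ) (hl : l ≤ m) (f : Opposite.op l ⟶ Opposite.op 0),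
      (M.hcTower n).map f (M.hcMk (by omega) x hx : M.HC (n + 2 * l)) =
      (M.hcMk (by omega) x hx : M.HC (n + 2 * 0)) from h m le_rfl f
  intro l hl f
  induction l with
  | zero =>
    obtain rfl : f = 𝟙 _ := Subsingleton.elim _ _
    rw [CategoryTheory.Functor.map_id]; rfl
  | succ l ih =>
    obtain rfl : f = (homOfLE (Nat.le_add_right l 1)).op ≫ (homOfLE (Nat.zero_le l)).op :=
      Subsingleton.elim _ _
    rw [CategoryTheory.Functor.map_comp]
    refine Eq.trans (congrArg ((M.hcTower n).map (homOfLE (Nat.zero_le l)).op) ?_) (ih (by omega) _)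
    have key : (M.hcTower n).map (homOfLE (Nat.le_add_right l 1)).op =
        ModuleCat.ofHom (M.S (n + 2 * l)) := Functor.ofOpSequence_map_homOfLE_succ _ l
    rw [key]
    exact M.S_hcMk (n := n + 2 * l) (by omega) x hx

variable {M}

/-- If `y` is a cycle up to the stabilization stage, its class in `HC_j` also comes from stage `n'`,
represented by some `y'`. In the degrees of `Tot_j` the two differ by a boundary `D w`, and
subtracting `D w` from `y'` does not alter `D y'`. -/
lemma IsMittagLeffler.exists_totDeg (h : M.IsMittagLeffler) (j : ℕ) :
    ∃ n, ∀ n' y, M.fullD y ∈ tail k M.V n → ∃ y', M.fullD y' ∈ tail k M.V n' ∧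
      ∀ i, TotDeg j i → (y' - y) i = 0 := by
  obtain ⟨⟨m⟩, f, hf⟩ := h j (Opposite.op 0)
  refine ⟨j + 2 * m, fun n' y hy => ?_⟩
  obtain ⟨c, hc⟩ := hf (homOfLE (Nat.zero_le n')).op ⟨M.hcMk le_rfl y hy, rfl⟩
  obtain ⟨y', hy', rfl⟩ := M.exists_hcMk (n := j + 2 * n') c
  have e := ((M.hcTower_map_hcMk j n' _ y' hy').symm.trans hc).trans (M.hcTower_map_hcMk j m f y hy)
  obtain ⟨w, hw⟩ := M.exists_fullD_of_hcMk_eq _ _ hy' hy e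
  refine ⟨y' - M.fullD w, ?_, fun i hi => ?_⟩
  · rw [map_sub, fullD_fullD, sub_zero]
    exact tail_anti (by omega) hy'
  · rw [sub_right_comm]
    exact hw i hi

lemma IsMittagLeffler.exists_approx (h : M.IsMittagLeffler) (j : ℕ) :
    ∃ n, ∀ n' y, M.fullD y ∈ tail k M.V n →
      ∃ y', M.fullD y' ∈ tail k M.V n' ∧ y' - y ∈ tail k M.V j := by
  -- The degrees of `Tot_{2j}` and `Tot_{2j+1}` together contain every degree below `j`. The even
  -- part of one approximation is joined to the odd part of the other, which is harmless since `D`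
  -- exchanges parities.
  obtain ⟨n₀, h₀⟩ := h.exists_totDeg (2 * j)
  obtain ⟨n₁, h₁⟩ := h.exists_totDeg (2 * j + 1)
  refine ⟨max n₀ n₁, fun n' y hy => ?_⟩
  obtain ⟨y₀, hy₀, e₀⟩ := h₀ n' y (tail_anti (le_max_left _ _) hy)
  obtain ⟨y₁, hy₁, e₁⟩ := h₁ n' y (tail_anti (le_max_right _ _) hy)
  refine ⟨M.part Even y₀ + M.part Odd y₁, ?_, fun i hi => ?_⟩
  · rw [map_add, fullD_part_even, fullD_part_odd]
    intro i hi
    by_cases h : Even i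
    · rw [Pi.add_apply, M.part_apply_of _ h, M.part_apply_of_not _ (Nat.not_odd_iff_even.2 h),
        hy₁ i hi, add_zero]
    · rw [Pi.add_apply, M.part_apply_of_not _ h, M.part_apply_of _ (Nat.not_even_iff_odd.1 h),
        hy₀ i hi, add_zero]
  · by_cases h : Even i
    · rw [Pi.sub_apply, Pi.add_apply, M.part_apply_of _ h,
        M.part_apply_of_not _ (Nat.not_odd_iff_even.2 h), add_zero]
      obtain ⟨r, rfl⟩ := h
      exact e₀ _ ⟨j - r, by omega⟩
    · have h' := Nat.not_even_iff_odd.1 h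
      rw [Pi.sub_apply, Pi.add_apply, M.part_apply_of_not _ h, M.part_apply_of _ h', zero_add]
      obtain ⟨r, rfl⟩ := h'
      exact e₁ _ ⟨j - r, by omega⟩

/-- The sign operator `x_j ↦ (-1)^j x_j`. -/
def sgn (M : MixedComplex.{u, v} k) : M.Full →ₗ[k] M.Full :=
  LinearMap.pi fun j => (-1 : k) ^ j • LinearMap.proj j

lemma sgn_apply (x : M.Full) (j : ℕ) : M.sgn x j = (-1 : k) ^ j • x j := rfl

lemma sgn_eq (x : M.Full) : M.sgn x = M.part Even x - M.part Odd x := by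
  funext j
  rcases Nat.even_or_odd j with h | h
  · simp [M.part_apply_of x h, M.part_apply_of_not (P := Odd) x (Nat.not_odd_iff_even.2 h),
      sgn_apply, h.neg_one_pow]
  · simp [M.part_apply_of x h, M.part_apply_of_not (P := Even) x (Nat.not_even_iff_odd.2 h),
      sgn_apply, h.neg_one_pow]

lemma part_even_part_even (x : M.Full) : M.part Even (M.part Even x) = M.part Even x :=
  congrArg (M.extZero Even) (M.res_extZero _)

lemma part_odd_part_odd (x : M.Full) : M.part Odd (M.part Odd x) = M.part Odd x :=
  congrArg (M.extZero Odd) (M.res_extZero _)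

lemma part_odd_part_even (x : M.Full) : M.part Odd (M.part Even x) = 0 := by
  have := M.part_even_add_odd (M.part Even x)
  rwa [part_even_part_even, add_eq_left] at this

lemma part_even_part_odd (x : M.Full) : M.part Even (M.part Odd x) = 0 := by
  have := M.part_even_add_odd (M.part Odd x)
  rwa [part_odd_part_odd, add_eq_right] at this

/-- The odd maps `s` with `s (M_even) ⊆ M_odd` and conversely. -/
def IsOdd (s : M.Full →ₗ[k] M.Full) : Prop :=
  ∀ x, M.part Even (s x) = s (M.part Odd x) ∧ M.part Odd (s x) = s (M.part Even x)

lemma IsOdd.sgn {s : M.Full →ₗ[k] M.Full} (hs : IsOdd s) (x : M.Full) :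
    s (M.sgn x) = - M.sgn (s x) := by
  rw [sgn_eq, sgn_eq, map_sub, (hs x).1, (hs x).2, neg_sub]

/-- Under the Mittag-Leffler condition `b + B` has a continuous odd generalized inverse. -/
theorem IsMittagLeffler.exists_generalizedInverse (h : M.IsMittagLeffler) :
    ∃ s : M.Full →ₗ[k] M.Full, Cont s ∧ IsOdd s ∧ ∀ y, M.fullD (s (M.fullD y)) = M.fullD y := by
  obtain ⟨s, hs, e⟩ := exists_cont_generalizedInverse M.cont_fullD fun i => by
    -- Openness of `D` onto its image: if `D y` is small, then `y` is close to a cycle `z`, and `y -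
    -- z` is small with the same boundary.
    obtain ⟨n, hn⟩ := exists_cycle_of_approx M.cont_fullD h.exists_approx i
    refine ⟨n, fun y hy => ?_⟩
    obtain ⟨z, hz, hz'⟩ := hn y hy
    exact ⟨y - z, hz', by rw [map_sub, hz, sub_zero]⟩
  -- Only the parity-reversing component of `s` is kept. As `D` reverses parity, this component
  -- alone still satisfies `D s D = D`.
  refine ⟨M.part Even ∘ₗ s ∘ₗ M.part Odd + M.part Odd ∘ₗ s ∘ₗ M.part Even,
    ((M.cont_part _).comp (hs.comp (M.cont_part _))).add
      ((M.cont_part _).comp (hs.comp (M.cont_part _))), fun x => ?_, fun y => ?_⟩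
  · simp only [LinearMap.add_apply, LinearMap.comp_apply, map_add, part_even_part_even,
      part_even_part_odd, part_odd_part_even, part_odd_part_odd, map_zero, add_zero, zero_add,
      and_self]
  · have h₀ : M.fullD (M.part Even (s (M.part Odd (M.fullD y)))) = M.part Odd (M.fullD y) := by
      rw [fullD_part_even, ← M.fullD_part_even y, e, fullD_part_even, part_odd_part_odd]
    have h₁ : M.fullD (M.part Odd (s (M.part Even (M.fullD y)))) = M.part Even (M.fullD y) := by
      rw [fullD_part_odd, ← M.fullD_part_odd y, e, fullD_part_odd, part_even_part_even]
    simp only [LinearMap.add_apply, LinearMap.comp_apply, map_add]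
    rw [h₀, h₁, add_comm, part_even_add_odd]

end MixedComplex

/-! ### Automatic continuity in finite dimension. -/

namespace ProductSpace

variable {k : Type*} [Field k] {V W : ℕ → Type*} {A : Type*}
  [∀ n, AddCommGroup (V n)] [∀ n, Module k (V n)] [∀ n, AddCommGroup (W n)] [∀ n, Module k (W n)]
  [AddCommGroup A] [Module k A]

/-- A closed subspace of finite codimension is open. -/
lemma finDep_of_finiteDimensional [FiniteDimensional k A] {Φ : (∀ n, V n) →ₗ[k] A}
    {r : (∀ n, V n) →ₗ[k] (∀ n, W n)} (hr : Cont r) (h : ∀ x, Φ x = 0 ↔ r x = 0) : FinDep Φ := by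
  -- The images under `Φ` of the tails decrease in a finite-dimensional space, so they are constant
  -- from some `n` on. Then, for `x` in the tail `n`, `Φ x` is attained on arbitrarily small `x'`;
  -- as `ker Φ = ker r`, this gives `r x = r x'`, whose coordinate `j` is zero when `x'` is small
  -- enough for `j`.
  obtain ⟨n, hn⟩ := IsArtinian.monotone_stabilizes (R := k) (M := A)
    ⟨fun m => OrderDual.toDual ((tail k V m).map Φ),
      fun m m' hm => Submodule.map_mono (tail_anti hm)⟩
  refine ⟨n, fun x hx => (h x).2 (funext fun j => ?_)⟩
  obtain ⟨m, hm⟩ := hr j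
  have e : (tail k V n).map Φ = (tail k V (max n m)).map Φ := hn _ (le_max_left n m)
  obtain ⟨x', hx', e'⟩ : Φ x ∈ (tail k V (max n m)).map Φ := e ▸ Submodule.mem_map_of_mem hx
  have h1 := (h (x' - x)).1 (by rw [map_sub, e', sub_self])
  rw [map_sub, sub_eq_zero] at h1
  rw [← h1]
  exact hm x' (tail_anti (le_max_right n m) hx')

end ProductSpace

/-! ### Cycles of the full product and their classes in periodic homology. -/

namespace MixedComplex

open ProductSpace

variable {k : Type u} [Field k] (M : MixedComplex.{u, v} k)

/-- The even part of a family. -/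
def res₀ : M.Full →ₗ[k] M.periodic.V₀ := M.res Even

/-- The odd part of a family. -/
def res₁ : M.Full →ₗ[k] M.periodic.V₁ := M.res Odd

/-- Extension by zero in odd degrees. -/
def ext₀ : M.periodic.V₀ →ₗ[k] M.Full := M.extZero Even

/-- Extension by zero in even degrees. -/
def ext₁ : M.periodic.V₁ →ₗ[k] M.Full := M.extZero Odd

lemma res₀_ext₀ (x : M.periodic.V₀) : M.res₀ (M.ext₀ x) = x := M.res_extZero (P := Even) x

lemma res₁_ext₁ (x : M.periodic.V₁) : M.res₁ (M.ext₁ x) = x := M.res_extZero (P := Odd) x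

lemma d₀_res₀ (x : M.Full) : M.periodic.d₀ (M.res₀ x) = M.res₁ (M.fullD x) :=
  (M.res_fullD (P := Even) (Q := Odd) (h₁ := fun _ h => h.add_one)
    (h₂ := even_of_odd_succ) x).symm

lemma d₁_res₁ (x : M.Full) : M.periodic.d₁ (M.res₁ x) = M.res₀ (M.fullD x) :=
  (M.res_fullD (P := Odd) (Q := Even) (h₁ := fun _ h => h.add_one)
    (h₂ := odd_of_even_succ) x).symm

lemma fullD_ext₀ (x : M.periodic.V₀) : M.fullD (M.ext₀ x) = M.ext₁ (M.periodic.d₀ x) :=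
  M.fullD_extZero (P := Even) (Q := Odd) (h₁ := fun _ h => h.add_one)
    (h₂ := even_of_odd_succ) odd_of_even_succ (fun _ h => h.add_one) x

lemma fullD_ext₁ (x : M.periodic.V₁) : M.fullD (M.ext₁ x) = M.ext₀ (M.periodic.d₁ x) :=
  M.fullD_extZero (P := Odd) (Q := Even) (h₁ := fun _ h => h.add_one)
    (h₂ := odd_of_even_succ) even_of_odd_succ (fun _ h => h.add_one) x

/-- The even part of a cycle, as a cycle of the periodic complex. -/
def resZ₀ : LinearMap.ker M.fullD →ₗ[k] LinearMap.ker M.periodic.d₀ :=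
  M.res₀.restrict fun x hx => by
    rw [LinearMap.mem_ker] at hx ⊢
    rw [d₀_res₀, hx, map_zero]

/-- The class in `HP₀` of the even part of a cycle. -/
def cls₀ : LinearMap.ker M.fullD →ₗ[k] M.HP₀ := Submodule.mkQ _ ∘ₗ M.resZ₀

/-- The odd part of a cycle, as a cycle of the periodic complex. -/
def resZ₁ : LinearMap.ker M.fullD →ₗ[k] LinearMap.ker M.periodic.d₁ :=
  M.res₁.restrict fun x hx => by
    rw [LinearMap.mem_ker] at hx ⊢
    rw [d₁_res₁, hx, map_zero]

/-- The class in `HP₁` of the odd part of a cycle. -/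
def cls₁ : LinearMap.ker M.fullD →ₗ[k] M.HP₁ := Submodule.mkQ _ ∘ₗ M.resZ₁

variable {M}

/-- The bounding family `u` may have mixed parity: only its odd part contributes to an even
boundary. -/
lemma cls₀_eq_zero_iff (x : LinearMap.ker M.fullD) :
    M.cls₀ x = 0 ↔ ∃ u, M.part Even x.1 = M.fullD u := by
  refine (Submodule.Quotient.mk_eq_zero (x := M.resZ₀ x)
    ((LinearMap.range M.periodic.d₁).submoduleOf (LinearMap.ker M.periodic.d₀))).trans ⟨?_, ?_⟩
  · rintro ⟨u, hu⟩
    exact ⟨M.ext₁ u, (congrArg M.ext₀ hu).symm.trans (M.fullD_ext₁ u).symm⟩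
  · rintro ⟨u, hu⟩
    refine ⟨M.res₁ u, ?_⟩
    rw [d₁_res₁, ← hu]
    exact M.res₀_ext₀ _

lemma exists_cls₀_eq (c : M.HP₀) :
    ∃ x : LinearMap.ker M.fullD, M.part Even x.1 = x.1 ∧ M.cls₀ x = c := by
  obtain ⟨⟨x, hx⟩, rfl⟩ := Submodule.Quotient.mk_surjective _ c
  have h : M.fullD (M.ext₀ x) = 0 := by
    rw [fullD_ext₀, LinearMap.mem_ker.1 hx, map_zero]
  exact ⟨⟨M.ext₀ x, h⟩, congrArg M.ext₀ (M.res₀_ext₀ x),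
    congrArg (Submodule.mkQ _) (Subtype.ext (M.res₀_ext₀ x) : M.resZ₀ ⟨_, h⟩ = ⟨x, hx⟩)⟩

lemma cls₁_eq_zero_iff (x : LinearMap.ker M.fullD) :
    M.cls₁ x = 0 ↔ ∃ u, M.part Odd x.1 = M.fullD u := by
  refine (Submodule.Quotient.mk_eq_zero (x := M.resZ₁ x)
    ((LinearMap.range M.periodic.d₀).submoduleOf (LinearMap.ker M.periodic.d₁))).trans ⟨?_, ?_⟩
  · rintro ⟨u, hu⟩
    exact ⟨M.ext₀ u, (congrArg M.ext₁ hu).symm.trans (M.fullD_ext₀ u).symm⟩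
  · rintro ⟨u, hu⟩
    refine ⟨M.res₀ u, ?_⟩
    rw [d₀_res₀, ← hu]
    exact M.res₁_ext₁ _

lemma exists_cls₁_eq (c : M.HP₁) :
    ∃ x : LinearMap.ker M.fullD, M.part Odd x.1 = x.1 ∧ M.cls₁ x = c := by
  obtain ⟨⟨x, hx⟩, rfl⟩ := Submodule.Quotient.mk_surjective _ c
  have h : M.fullD (M.ext₁ x) = 0 := by
    rw [fullD_ext₁, LinearMap.mem_ker.1 hx, map_zero]
  exact ⟨⟨M.ext₁ x, h⟩, congrArg M.ext₁ (M.res₁_ext₁ x),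
    congrArg (Submodule.mkQ _) (Subtype.ext (M.res₁_ext₁ x) : M.resZ₁ ⟨_, h⟩ = ⟨x, hx⟩)⟩

lemma cls₀_of_odd {x : LinearMap.ker M.fullD} (h : M.part Odd x.1 = x.1) : M.cls₀ x = 0 :=
  (cls₀_eq_zero_iff x).2 ⟨0, by rw [← h, part_even_part_odd, map_zero]⟩

lemma cls₁_of_even {x : LinearMap.ker M.fullD} (h : M.part Even x.1 = x.1) : M.cls₁ x = 0 :=
  (cls₁_eq_zero_iff x).2 ⟨0, by rw [← h, part_odd_part_even, map_zero]⟩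

/-! ### Continuous contractions onto periodic homology. -/

variable (M) in
/-- A continuous contraction of the periodic complex of `M` onto finitely many cycles representing
bases of `HP₀` and `HP₁`. -/
structure FiniteContraction where
  ι₀ : Type
  ι₁ : Type
  [fintype₀ : Fintype ι₀]
  [fintype₁ : Fintype ι₁]
  basis₀ : Module.Basis ι₀ k M.HP₀
  basis₁ : Module.Basis ι₁ k M.HP₁
  z₀ : ι₀ → LinearMap.ker M.fullD
  z₁ : ι₁ → LinearMap.ker M.fullD
  part_z₀ : ∀ a, M.part Even (z₀ a).1 = (z₀ a).1
  part_z₁ : ∀ a, M.part Odd (z₁ a).1 = (z₁ a).1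
  cls_z₀ : ∀ a, M.cls₀ (z₀ a) = basis₀ a
  cls_z₁ : ∀ a, M.cls₁ (z₁ a) = basis₁ a
  /-- the coordinates of the retraction -/
  φ₀ : M.Full →ₗ[k] M.HP₀
  φ₁ : M.Full →ₗ[k] M.HP₁
  finDep₀ : FinDep φ₀
  finDep₁ : FinDep φ₁
  φ₀_fullD : ∀ x, φ₀ (M.fullD x) = 0
  φ₁_fullD : ∀ x, φ₁ (M.fullD x) = 0
  -- Parity is recorded through `sgn`, the form in which it meets the Koszul sign of `fullD_box`.
  φ₀_sgn : ∀ x, φ₀ (M.sgn x) = φ₀ x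
  φ₁_sgn : ∀ x, φ₁ (M.sgn x) = - φ₁ x
  φ₀_cycle : ∀ x : LinearMap.ker M.fullD, φ₀ x.1 = M.cls₀ x
  φ₁_cycle : ∀ x : LinearMap.ker M.fullD, φ₁ x.1 = M.cls₁ x
  /-- the homotopy -/
  s : M.Full →ₗ[k] M.Full
  cont_s : Cont s
  s_sgn : ∀ x, s (M.sgn x) = - M.sgn (s x)
  contraction : ∀ x, x = ∑ a, basis₀.repr (φ₀ x) a • (z₀ a).1 +
    ∑ a, basis₁.repr (φ₁ x) a • (z₁ a).1 + M.fullD (s x) + s (M.fullD x)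

attribute [instance] FiniteContraction.fintype₀ FiniteContraction.fintype₁

/-- A mixed complex with the Mittag-Leffler property and finite-dimensional periodic homology
contracts onto its periodic homology. -/
theorem IsMittagLeffler.nonempty_finiteContraction (h : M.IsMittagLeffler)
    [FiniteDimensional k M.HP₀] [FiniteDimensional k M.HP₁] : Nonempty M.FiniteContraction := by
  obtain ⟨s, hs, hodd, e⟩ := h.exists_generalizedInverse
  -- From `D s D = D` follow `D p = 0` and `p D = 0`. No idempotence is claimed; the homotopy is
  -- corrected at the end instead.
  let p : M.Full →ₗ[k] M.Full := LinearMap.id - M.fullD ∘ₗ s - s ∘ₗ M.fullD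
  have hp : ∀ x, p x = x - M.fullD (s x) - s (M.fullD x) := fun _ => rfl
  have hpc : Cont p := (Cont.id.sub (M.cont_fullD.comp hs)).sub (hs.comp M.cont_fullD)
  have hDp : ∀ x, M.fullD (p x) = 0 := fun x => by
    rw [hp, map_sub, map_sub, e, fullD_fullD]; simp
  have hpD : ∀ x, p (M.fullD x) = 0 := fun x => by
    rw [hp, e, fullD_fullD]; simp
  have hpE : ∀ x, p (M.part Even x) = M.part Even (p x) := fun x => by
    rw [hp, hp, map_sub, map_sub, fullD_part_even, ← (hodd _).2, ← (hodd _).1, fullD_part_odd]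
  have hpO : ∀ x, p (M.part Odd x) = M.part Odd (p x) := fun x => by
    rw [hp, hp, map_sub, map_sub, fullD_part_odd, ← (hodd _).2, ← (hodd _).1, fullD_part_even]
  have hsgn : ∀ x, p (M.sgn x) = M.sgn (p x) := fun x => by
    rw [sgn_eq, map_sub, hpE, hpO, sgn_eq]
  let p' : M.Full →ₗ[k] LinearMap.ker M.fullD := p.codRestrict _ hDp
  -- The kernel of `r` is exactly the space of boundaries, which is therefore closed.
  let r : M.Full →ₗ[k] M.Full := LinearMap.id - M.fullD ∘ₗ s
  have hr : Cont r := Cont.id.sub (M.cont_fullD.comp hs)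
  have hr0 : ∀ x, r x = 0 ↔ ∃ u, x = M.fullD u := fun x => by
    refine ⟨fun hx => ⟨s x, sub_eq_zero.1 hx⟩, ?_⟩
    rintro ⟨u, rfl⟩
    exact sub_eq_zero.2 (e u).symm
  let φ₀ := M.cls₀ ∘ₗ p'
  let φ₁ := M.cls₁ ∘ₗ p'
  have hφ₀ : ∀ x, φ₀ x = M.cls₀ (p' x) := fun _ => rfl
  have hφ₁ : ∀ x, φ₁ x = M.cls₁ (p' x) := fun _ => rfl
  have hcyc : ∀ x : LinearMap.ker M.fullD, ∃ u, (p' x.1 - x).1 = M.fullD u := fun x =>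
    ⟨- s x.1, by
      change p x.1 - x.1 = _
      rw [hp, LinearMap.mem_ker.1 x.2, map_zero, map_neg]; abel⟩
  let β₀ := Module.finBasis k M.HP₀
  let β₁ := Module.finBasis k M.HP₁
  choose z₀ hz₀ hz₀' using fun a => exists_cls₀_eq (β₀ a)
  choose z₁ hz₁ hz₁' using fun a => exists_cls₁_eq (β₁ a)
  have hφ₀D : ∀ x, φ₀ (M.fullD x) = 0 := fun x => by
    rw [hφ₀, (Subtype.ext (hpD x) : p' (M.fullD x) = 0), map_zero]
  have hφ₁D : ∀ x, φ₁ (M.fullD x) = 0 := fun x => by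
    rw [hφ₁, (Subtype.ext (hpD x) : p' (M.fullD x) = 0), map_zero]
  have hφ₀O : ∀ x, φ₀ (M.part Odd x) = 0 := fun x => by
    refine cls₀_of_odd ?_
    change M.part Odd (p (M.part Odd x)) = p (M.part Odd x)
    rw [hpO, part_odd_part_odd]
  have hφ₁E : ∀ x, φ₁ (M.part Even x) = 0 := fun x => by
    refine cls₁_of_even ?_
    change M.part Even (p (M.part Even x)) = p (M.part Even x)
    rw [hpE, part_even_part_even]
  have hφ₀s : ∀ x, φ₀ (M.sgn x) = φ₀ x := fun x => by
    have := congrArg φ₀ (M.part_even_add_odd x)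
    rw [map_add, hφ₀O, add_zero] at this
    rw [sgn_eq, map_sub, hφ₀O, sub_zero, this]
  have hφ₁s : ∀ x, φ₁ (M.sgn x) = - φ₁ x := fun x => by
    have := congrArg φ₁ (M.part_even_add_odd x)
    rw [map_add, hφ₁E, zero_add] at this
    rw [sgn_eq, map_sub, hφ₁E, zero_sub, this]
  -- `φ₀ x = 0` means that the even part of `p x` is a boundary, that is, `r` kills it. So `φ₀` has
  -- the kernel of a continuous map and takes values in a finite-dimensional space.
  have hφ₀c : FinDep φ₀ := finDep_of_finiteDimensional (hr.comp ((M.cont_part Even).comp hpc))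
    fun x => (cls₀_eq_zero_iff _).trans (hr0 _).symm
  have hφ₁c : FinDep φ₁ := finDep_of_finiteDimensional (hr.comp ((M.cont_part Odd).comp hpc))
    fun x => (cls₁_eq_zero_iff _).trans (hr0 _).symm
  let q₀ : M.Full →ₗ[k] LinearMap.ker M.fullD := ∑ a, (β₀.coord a ∘ₗ φ₀).smulRight (z₀ a)
  let q₁ : M.Full →ₗ[k] LinearMap.ker M.fullD := ∑ a, (β₁.coord a ∘ₗ φ₁).smulRight (z₁ a)
  -- `q x` replaces the cycle `p x` by the combination of chosen representatives with the same
  -- classes in `HP₀` and `HP₁`.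
  let q : M.Full →ₗ[k] M.Full := (LinearMap.ker M.fullD).subtype ∘ₗ (q₀ + q₁)
  have hq₀ : ∀ x, q₀ x = ∑ a, β₀.repr (φ₀ x) a • z₀ a := fun x => by simp [q₀]
  have hq₁ : ∀ x, q₁ x = ∑ a, β₁.repr (φ₁ x) a • z₁ a := fun x => by simp [q₁]
  have hq : ∀ x, q x = ∑ a, β₀.repr (φ₀ x) a • (z₀ a).1 + ∑ a, β₁.repr (φ₁ x) a • (z₁ a).1 :=
    fun x => by
      change ((q₀ x + q₁ x : LinearMap.ker M.fullD) : M.Full) = _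
      rw [hq₀, hq₁]; simp
  have hqc : Cont q := by
    have : q = ∑ a, (β₀.coord a ∘ₗ φ₀).smulRight (z₀ a).1 +
        ∑ a, (β₁.coord a ∘ₗ φ₁).smulRight (z₁ a).1 := by
      ext1 x; rw [hq]; simp
    rw [this]
    exact (Cont.sum _ fun a _ => .smulRight (hφ₀c.comp_left _) _).add
      (Cont.sum _ fun a _ => .smulRight (hφ₁c.comp_left _) _)
  have hqsgn : ∀ x, q (M.sgn x) = M.sgn (q x) := fun x => by
    have h0 : ∀ a, M.sgn (z₀ a).1 = (z₀ a).1 := fun a => by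
      rw [sgn_eq, hz₀, ← hz₀ a, part_odd_part_even, sub_zero]
    have h1 : ∀ a, M.sgn (z₁ a).1 = -(z₁ a).1 := fun a => by
      rw [sgn_eq, hz₁, ← hz₁ a, part_even_part_odd, zero_sub]
    simp [hq, hφ₀s, hφ₁s, map_add, map_sum, h0, h1]
  -- Both classes of the cycle `p x - q x` are zero, so it is a boundary, and `D s` fixes
  -- boundaries.
  have hpq : ∀ x, M.fullD (s (p x - q x)) = p x - q x := by
    intro x
    obtain ⟨u₀, hu₀⟩ := (cls₀_eq_zero_iff (p' x - (q₀ x + q₁ x))).1 (by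
      rw [map_sub, map_add, hq₀, hq₁, map_sum, map_sum]
      simp_rw [map_smul, hz₀', cls₀_of_odd (hz₁ _), smul_zero]
      rw [β₀.sum_repr, Finset.sum_const_zero, add_zero, hφ₀, sub_self])
    obtain ⟨u₁, hu₁⟩ := (cls₁_eq_zero_iff (p' x - (q₀ x + q₁ x))).1 (by
      rw [map_sub, map_add, hq₀, hq₁, map_sum, map_sum]
      simp_rw [map_smul, hz₁', cls₁_of_even (hz₀ _), smul_zero]
      rw [β₁.sum_repr, Finset.sum_const_zero, zero_add, hφ₁, sub_self])
    have : p x - q x = M.fullD (u₀ + u₁) := by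
      rw [map_add, ← hu₀, ← hu₁, part_even_add_odd]; rfl
    rw [this, e]
  -- The correction `s ∘ (p - q)` contributes `D s (p - q) = p - q`, while `s (p - q) D = 0`; this
  -- turns `1 = p + D s + s D` into a contraction onto the image of `q`.
  refine ⟨⟨_, _, β₀, β₁, z₀, z₁, hz₀, hz₁, hz₀', hz₁', φ₀, φ₁, hφ₀c, hφ₁c, hφ₀D, hφ₁D, hφ₀s, hφ₁s,
    fun x => ?_, fun x => ?_, s + s ∘ₗ (p - q), hs.add (hs.comp (hpc.sub hqc)), fun x => ?_,
    fun x => ?_⟩⟩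
  · obtain ⟨u, hu⟩ := hcyc x
    rw [hφ₀, ← sub_eq_zero, ← map_sub, cls₀_eq_zero_iff, hu]
    exact ⟨M.part Odd u, (M.fullD_part_odd u).symm⟩
  · obtain ⟨u, hu⟩ := hcyc x
    rw [hφ₁, ← sub_eq_zero, ← map_sub, cls₁_eq_zero_iff, hu]
    exact ⟨M.part Even u, (M.fullD_part_even u).symm⟩
  · have hss := hodd.sgn
    simp only [LinearMap.add_apply, LinearMap.comp_apply, LinearMap.sub_apply, hsgn, hqsgn, hss,
      ← map_sub, map_add]
    abel
  · have hqD : q (M.fullD x) = 0 := by rw [hq, hφ₀D, hφ₁D]; simp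
    rw [← hq]
    simp only [LinearMap.add_apply, LinearMap.comp_apply, LinearMap.sub_apply, hpD, hqD,
      map_add, hpq, sub_self, map_zero]
    rw [hp]
    abel

end MixedComplex

/-! ### The completed tensor product and operators on it. -/

namespace MixedComplex

open ProductSpace

variable {k : Type u} [Field k] (M : MixedComplex.{u, v} k) (M' : MixedComplex.{u, w} k)

/-- The exterior product `{x_p} ⊠ {y_q} = {x_p ⊗ y_q}_{p + q = n}` of families. -/
def box : M.Full →ₗ[k] M'.Full →ₗ[k] (M.tensor M').Full :=
  LinearMap.mk₂ k (fun x y _ pq => x pq.1.1 ⊗ₜ[k] y pq.1.2)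
    (fun x x' y => by funext n pq; simp [TensorProduct.add_tmul])
    (fun c x y => by funext n pq; simp [TensorProduct.smul_tmul'])
    (fun x y y' => by funext n pq; simp [TensorProduct.tmul_add])
    (fun c x y => by funext n pq; simp)

lemma box_apply (x : M.Full) (y : M'.Full) (n : ℕ) (pq : {pq : ℕ × ℕ // pq.1 + pq.2 = n}) :
    M.box M' x y n pq = x pq.1.1 ⊗ₜ[k] y pq.1.2 := rfl

/-- The Leibniz rule. A family has components in all degrees, so the sign `(-1)^p` is not a scalar
but the operator `sgn`. -/
lemma fullD_box (x : M.Full) (y : M'.Full) :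
    (M.tensor M').fullD (M.box M' x y) =
      M.box M' (M.fullD x) y + M.box M' (M.sgn x) (M'.fullD y) := by
  have key : ∀ (n : ℕ) (pq : {pq : ℕ × ℕ // pq.1 + pq.2 = n}),
      (M.box M' (M.fullD x) y + M.box M' (M.sgn x) (M'.fullD y)) n pq =
      M.fullD x pq.1.1 ⊗ₜ[k] y pq.1.2 +
        (-1 : k) ^ pq.1.1 • (x pq.1.1 ⊗ₜ[k] M'.fullD y pq.1.2) := fun n pq => by
    rw [TensorProduct.smul_tmul']; rfl
  funext n
  obtain _ | n := n
  · funext ⟨⟨p, q⟩, h⟩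
    obtain ⟨rfl, rfl⟩ : p = 0 ∧ q = 0 := by dsimp only at h; omega
    refine Eq.trans ?_ (key _ ⟨_, h⟩).symm
    exact M.tensorb_apply M' _ 0 0 h
  · rw [fullD_succ]
    funext ⟨⟨p, q⟩, h⟩
    refine Eq.trans ?_ (key _ ⟨_, h⟩).symm
    refine (congrArg₂ (· + ·) (M.tensorb_apply M' _ p q h) rfl).trans ?_
    rcases p with _ | p <;> rcases q with _ | q
    · exfalso; dsimp only at h; omega
    · refine (congrArg₂ (· + ·) rfl (M.tensorB_apply_zero_succ M' _ q h)).trans ?_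
      simp only [box_apply, LinearMap.rTensor_tmul, LinearMap.lTensor_tmul, fullD_zero, fullD_succ,
        TensorProduct.tmul_add, pow_zero, one_smul, add_assoc]
    · refine (congrArg₂ (· + ·) rfl (M.tensorB_apply_succ_zero M' _ p h)).trans ?_
      simp only [box_apply, LinearMap.rTensor_tmul, LinearMap.lTensor_tmul, fullD_zero, fullD_succ,
        TensorProduct.add_tmul]
      exact add_right_comm _ _ _
    · refine (congrArg₂ (· + ·) rfl (M.tensorB_apply_succ_succ M' _ p q h)).trans ?_
      simp only [box_apply, LinearMap.rTensor_tmul, LinearMap.lTensor_tmul, fullD_succ,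
        TensorProduct.add_tmul, TensorProduct.tmul_add, smul_add]
      exact add_add_add_comm _ _ _ _

variable {M M'} {A : Type*} [AddCommGroup A] [Module k A]

lemma single_box (p q : ℕ) (x : M.V p) (y : M'.V q) :
    M.box M' (Pi.single p x) (Pi.single q y) =
      Pi.single (M := M.tensorV M') (p + q) (Pi.single
        (M := fun pq : {pq : ℕ × ℕ // pq.1 + pq.2 = p + q} => M.V pq.1.1 ⊗[k] M'.V pq.1.2)
        ⟨(p, q), rfl⟩ (x ⊗ₜ[k] y)) := by
  funext n ⟨⟨p', q'⟩, h⟩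
  dsimp only at h
  subst h
  rw [box_apply]
  dsimp only
  by_cases hp : p' = p
  · subst hp
    by_cases hq : q' = q
    · subst hq; simp
    · rw [Pi.single_eq_of_ne hq, TensorProduct.tmul_zero,
        Pi.single_eq_of_ne (show p' + q' ≠ p' + q by omega)]; rfl
  · rw [Pi.single_eq_of_ne hp, TensorProduct.zero_tmul]
    by_cases hn : p' + q' = p + q
    -- The degree `n` is freed so that `p + q = n` can be substituted; the outer `Pi.single` then
    -- reduces without a cast between index types.
    · have : ∀ (n : ℕ) (hn : p + q = n) (hn' : p' + q' = n),
          (Pi.single (M := M.tensorV M') (p + q) (Pi.single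
            (M := fun pq : {pq : ℕ × ℕ // pq.1 + pq.2 = p + q} => M.V pq.1.1 ⊗[k] M'.V pq.1.2)
            ⟨(p, q), rfl⟩ (x ⊗ₜ[k] y)) : (M.tensor M').Full) n
            ⟨(p', q'), hn'⟩ = 0 := by
        rintro _ rfl hn'
        rw [Pi.single_eq_same, Pi.single_eq_of_ne]
        intro h
        exact hp (congrArg (fun z => z.1.1) h)
      exact (this _ hn.symm rfl).symm
    · rw [Pi.single_eq_of_ne hn]; rfl

/-- A continuous linear map on the completed tensor product is determined by its values on
exterior products. -/
lemma eq_zero_of_box {f : (M.tensor M').Full →ₗ[k] A} (hf : FinDep f)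
    (h : ∀ x y, f (M.box M' x y) = 0) : f = 0 := by
  refine hf.eq_zero fun n => ?_
  have : Finite {pq : ℕ × ℕ // pq.1 + pq.2 = n} :=
    Finite.of_equiv (Finset.HasAntidiagonal.antidiagonal n)
      (Equiv.subtypeEquivRight fun _ => Finset.HasAntidiagonal.mem_antidiagonal)
  -- In one degree the product over `p + q = n` is finite, hence a direct sum spanned by pure
  -- tensors, and these are exterior products of concentrated families.
  suffices f ∘ₗ LinearMap.single k _ n = 0 from LinearMap.congr_fun this
  refine LinearMap.pi_ext' ?_
  rintro ⟨⟨p, q⟩, rfl⟩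
  refine TensorProduct.ext' fun x y => ?_
  exact (congrArg f (single_box p q x y)).symm.trans (h _ _)

/-- Identities between continuous operators thereby reduce to exterior products, where the Leibniz
rule applies. -/
lemma Cont.eq_of_box {W : ℕ → Type*} [∀ n, AddCommGroup (W n)] [∀ n, Module k (W n)]
    {f g : (M.tensor M').Full →ₗ[k] (∀ n, W n)} (hf : Cont f) (hg : Cont g)
    (h : ∀ x y, f (M.box M' x y) = g (M.box M' x y)) (w : (M.tensor M').Full) : f w = g w := by
  funext j
  have := eq_zero_of_box (hf.sub hg j) fun x y => by simp [h]
  exact sub_eq_zero.1 (LinearMap.congr_fun this w)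

lemma cont_box (x : M.Full) : Cont (M.box M' x) := fun n =>
  ⟨n + 1, fun y hy => by
    funext ⟨⟨p, q⟩, h⟩
    dsimp only at h
    rw [LinearMap.comp_apply, LinearMap.proj_apply, box_apply]
    dsimp only
    rw [hy q (by omega), TensorProduct.tmul_zero]; rfl⟩

/-- The map `f ⊗ 1` on the completed tensor product induced by a continuous map `f`, followed by
projection to one component of the second factor. -/
def slant {f : M.Full →ₗ[k] A} (hf : FinDep f) (q : ℕ) :
    (M.tensor M').Full →ₗ[k] A ⊗[k] M'.V q :=
  ∑ j ∈ Finset.range hf.choose, (f ∘ₗ LinearMap.single k M.V j).rTensor (M'.V q) ∘ₗ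
    LinearMap.proj (⟨(j, q), rfl⟩ : {pq : ℕ × ℕ // pq.1 + pq.2 = j + q}) ∘ₗ LinearMap.proj (j + q)

lemma finDep_slant {f : M.Full →ₗ[k] A} (hf : FinDep f) (q : ℕ) :
    FinDep (slant (M' := M') hf q) :=
  FinDep.sum _ fun j _ => FinDep.comp_left (FinDep.comp_left (FinDep.proj (j + q)) _) _

/-- Truncating `x` at the bound `hf.choose` changes it by an element of a tail on which `f`
vanishes, so the finite sum defining `slant` already yields `f x`. -/
lemma slant_box {f : M.Full →ₗ[k] A} (hf : FinDep f) (q : ℕ) (x : M.Full) (y : M'.Full) :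
    slant hf q (M.box M' x y) = f x ⊗ₜ[k] y q := by
  rw [slant, LinearMap.sum_apply]
  refine Eq.trans (TensorProduct.sum_tmul (Finset.range hf.choose)
    (fun j => f (Pi.single j (x j))) (y q)).symm ?_
  rw [← map_sum]
  congr 1
  have hx : x - ∑ j ∈ Finset.range hf.choose, Pi.single j (x j) ∈ tail k M.V hf.choose := by
    intro j hj
    rw [Pi.sub_apply, Finset.sum_apply, Finset.sum_eq_single_of_mem j (Finset.mem_range.2 hj)]
    · simp
    · intro i _ hij
      rw [Pi.single_eq_of_ne hij.symm]
  have := hf.choose_spec _ hx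
  rw [map_sub, sub_eq_zero] at this
  exact this.symm

/-- The map `φ ⊗ 1` for a continuous linear form `φ`. -/
def slantForm {φ : M.Full →ₗ[k] k} (hφ : FinDep φ) : (M.tensor M').Full →ₗ[k] M'.Full :=
  LinearMap.pi fun q => (TensorProduct.lid k (M'.V q)).toLinearMap ∘ₗ slant hφ q

lemma cont_slantForm {φ : M.Full →ₗ[k] k} (hφ : FinDep φ) : Cont (slantForm (M' := M') hφ) :=
  fun q => (finDep_slant hφ q).comp_left (TensorProduct.lid k (M'.V q)).toLinearMap

lemma slantForm_box {φ : M.Full →ₗ[k] k} (hφ : FinDep φ) (x : M.Full) (y : M'.Full) :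
    slantForm hφ (M.box M' x y) = φ x • y := by
  funext q
  simp [slantForm, slant_box]

/-- The map `s ⊗ 1` for a continuous endomorphism `s`. -/
def slantEnd {s : M.Full →ₗ[k] M.Full} (hs : Cont s) :
    (M.tensor M').Full →ₗ[k] (M.tensor M').Full :=
  LinearMap.pi fun _ => LinearMap.pi fun pq => slant (hs pq.1.1) pq.1.2

lemma slantEnd_box {s : M.Full →ₗ[k] M.Full} (hs : Cont s) (x : M.Full) (y : M'.Full) :
    slantEnd hs (M.box M' x y) = M.box M' (s x) y := by
  funext n pq
  exact slant_box (hs pq.1.1) _ x y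

lemma cont_slantEnd {s : M.Full →ₗ[k] M.Full} (hs : Cont s) :
    Cont (slantEnd (M' := M') hs) := by
  intro n
  have : Finite {pq : ℕ × ℕ // pq.1 + pq.2 = n} :=
    Finite.of_equiv (Finset.HasAntidiagonal.antidiagonal n)
      (Equiv.subtypeEquivRight fun _ => Finset.HasAntidiagonal.mem_antidiagonal)
  have := Fintype.ofFinite {pq : ℕ × ℕ // pq.1 + pq.2 = n}
  -- Only finitely many pairs have total degree `n`, so their bounds have a common maximum.
  choose N hN using fun pq : {pq : ℕ × ℕ // pq.1 + pq.2 = n} =>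
    finDep_slant (M' := M') (hs pq.1.1) pq.1.2
  refine ⟨Finset.univ.sup N, fun x hx => funext fun pq => hN pq x ?_⟩
  exact tail_anti (Finset.le_sup (Finset.mem_univ pq)) hx

/-- On `x ⊠ y` the Leibniz rule leaves `φ (D x) y + φ (sgn x) D y`, which is `c φ(x) D y`. -/
lemma fullD_slantForm {φ : M.Full →ₗ[k] k} (hφ : FinDep φ) (c : k) (hc : ∀ x, φ (M.sgn x) = c * φ x)
    (hD : ∀ x, φ (M.fullD x) = 0) (w : (M.tensor M').Full) :
    slantForm hφ ((M.tensor M').fullD w) = c • M'.fullD (slantForm hφ w) := by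
  refine Cont.eq_of_box (f := slantForm hφ ∘ₗ (M.tensor M').fullD)
    (g := c • M'.fullD ∘ₗ slantForm hφ) ((cont_slantForm hφ).comp (cont_fullD _))
    ((M'.cont_fullD.comp (cont_slantForm hφ)).smul c) (fun x y => ?_) w
  simp only [LinearMap.comp_apply, LinearMap.smul_apply, fullD_box, map_add, slantForm_box, hD, hc,
    zero_smul, zero_add, map_smul, mul_smul]

/-! ### Tensoring the contraction with the identity. -/

namespace FiniteContraction

variable (c : M.FiniteContraction)

/-- The linear forms on `M.Full` giving the coordinates in `HP₀`. -/
def form₀ (a : c.ι₀) : M.Full →ₗ[k] k := c.basis₀.coord a ∘ₗ c.φ₀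

/-- The linear forms on `M.Full` giving the coordinates in `HP₁`. -/
def form₁ (a : c.ι₁) : M.Full →ₗ[k] k := c.basis₁.coord a ∘ₗ c.φ₁

lemma finDep_form₀ (a : c.ι₀) : FinDep (c.form₀ a) := c.finDep₀.comp_left _

lemma finDep_form₁ (a : c.ι₁) : FinDep (c.form₁ a) := c.finDep₁.comp_left _

lemma fullD_slantForm₀ (a : c.ι₀) (w : (M.tensor M').Full) :
    slantForm (c.finDep_form₀ a) ((M.tensor M').fullD w) =
      M'.fullD (slantForm (c.finDep_form₀ a) w) := by
  rw [fullD_slantForm (c.finDep_form₀ a) 1 (fun x => by simp [form₀, c.φ₀_sgn])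
    (fun x => by simp [form₀, c.φ₀_fullD]), one_smul]

lemma fullD_slantForm₁ (a : c.ι₁) (w : (M.tensor M').Full) :
    slantForm (c.finDep_form₁ a) ((M.tensor M').fullD w) =
      - M'.fullD (slantForm (c.finDep_form₁ a) w) := by
  rw [fullD_slantForm (c.finDep_form₁ a) (-1) (fun x => by simp [form₁, c.φ₁_sgn])
    (fun x => by simp [form₁, c.φ₁_fullD]), neg_one_smul]

/-- On `x ⊠ y`, `D (s ⊗ 1) + (s ⊗ 1) D` produces the cross terms `sgn (s x) ⊠ D y` and `s (sgn x) ⊠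
D y`, which cancel because `s` anticommutes with `sgn`. What remains is the contraction of `x`,
multiplied by `y`. -/
lemma tensor_contraction (w : (M.tensor M').Full) :
    w = ∑ a, M.box M' (c.z₀ a).1 (slantForm (c.finDep_form₀ a) w) +
      ∑ a, M.box M' (c.z₁ a).1 (slantForm (c.finDep_form₁ a) w) +
      (M.tensor M').fullD (slantEnd c.cont_s w) + slantEnd c.cont_s ((M.tensor M').fullD w) := by
  have hcont : Cont (∑ a, M.box M' (c.z₀ a).1 ∘ₗ slantForm (c.finDep_form₀ a) +
      ∑ a, M.box M' (c.z₁ a).1 ∘ₗ slantForm (c.finDep_form₁ a) +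
      (M.tensor M').fullD ∘ₗ slantEnd c.cont_s + slantEnd c.cont_s ∘ₗ (M.tensor M').fullD) :=
    (((Cont.sum _ fun a _ => (cont_box _).comp (cont_slantForm _)).add
      (Cont.sum _ fun a _ => (cont_box _).comp (cont_slantForm _))).add
      ((cont_fullD _).comp (cont_slantEnd _))).add ((cont_slantEnd _).comp (cont_fullD _))
  refine (Cont.eq_of_box Cont.id hcont (fun x y => ?_) w).trans (by
    simp only [LinearMap.add_apply, LinearMap.sum_apply, LinearMap.comp_apply])
  simp only [LinearMap.add_apply, LinearMap.sum_apply, LinearMap.comp_apply, LinearMap.id_apply,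
    slantForm_box, slantEnd_box, fullD_box, map_add, map_smul, c.s_sgn, map_neg,
    LinearMap.neg_apply]
  have h := congrArg (fun z => M.box M' z y) (c.contraction x)
  simp only [map_add, map_sum, map_smul, LinearMap.add_apply, LinearMap.sum_apply,
    LinearMap.smul_apply] at h
  refine h.trans ?_
  simp only [form₀, form₁, LinearMap.comp_apply, Module.Basis.coord_apply]
  abel

/-- The chain-level source of surjectivity: in the contraction of a cycle the last term drops out,
and the coefficients are cycles because `φ_a ⊗ 1` commutes with `D` up to sign. -/
lemma exists_cycles {w : (M.tensor M').Full} (hw : (M.tensor M').fullD w = 0) :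
    ∃ (y₀ : c.ι₀ → LinearMap.ker M'.fullD) (y₁ : c.ι₁ → LinearMap.ker M'.fullD),
      ∃ u, w - (∑ a, M.box M' (c.z₀ a).1 (y₀ a).1 + ∑ a, M.box M' (c.z₁ a).1 (y₁ a).1) =
        (M.tensor M').fullD u := by
  refine ⟨fun a => ⟨slantForm (c.finDep_form₀ a) w, ?_⟩,
    fun a => ⟨slantForm (c.finDep_form₁ a) w, ?_⟩, slantEnd c.cont_s w, ?_⟩
  · rw [LinearMap.mem_ker, ← fullD_slantForm₀, hw, map_zero]
  · rw [LinearMap.mem_ker, ← neg_eq_zero, ← fullD_slantForm₁, hw, map_zero]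
  · have := c.tensor_contraction w
    rw [hw, map_zero, add_zero] at this
    rw [sub_eq_iff_eq_add']
    exact this

lemma form₀_z₀ [DecidableEq c.ι₀] (a b : c.ι₀) :
    c.form₀ a (c.z₀ b).1 = if b = a then 1 else 0 := by
  rw [form₀, LinearMap.comp_apply, c.φ₀_cycle, c.cls_z₀, Module.Basis.coord_apply,
    Module.Basis.repr_self, Finsupp.single_apply]

lemma form₁_z₁ [DecidableEq c.ι₁] (a b : c.ι₁) :
    c.form₁ a (c.z₁ b).1 = if b = a then 1 else 0 := by
  rw [form₁, LinearMap.comp_apply, c.φ₁_cycle, c.cls_z₁, Module.Basis.coord_apply,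
    Module.Basis.repr_self, Finsupp.single_apply]

lemma form₀_z₁ (a : c.ι₀) (b : c.ι₁) : c.form₀ a (c.z₁ b).1 = 0 := by
  rw [form₀, LinearMap.comp_apply, c.φ₀_cycle, cls₀_of_odd (c.part_z₁ b), map_zero]

lemma form₁_z₀ (a : c.ι₁) (b : c.ι₀) : c.form₁ a (c.z₀ b).1 = 0 := by
  rw [form₁, LinearMap.comp_apply, c.φ₁_cycle, cls₁_of_even (c.part_z₀ b), map_zero]

/-- The chain-level source of injectivity: since `φ_a (z_b) = δ_ab`, the map `φ_a ⊗ 1` isolates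
`y_a` on the left and gives a boundary on the right. For the odd forms it anticommutes with `D`,
whence the sign in the second witness. -/
lemma exists_of_sum_box {y₀ : c.ι₀ → M'.Full} {y₁ : c.ι₁ → M'.Full} {u : (M.tensor M').Full}
    (h : ∑ a, M.box M' (c.z₀ a).1 (y₀ a) + ∑ a, M.box M' (c.z₁ a).1 (y₁ a) =
      (M.tensor M').fullD u) :
    (∀ a, ∃ v, y₀ a = M'.fullD v) ∧ ∀ a, ∃ v, y₁ a = M'.fullD v := by
  classical
  refine ⟨fun a => ⟨slantForm (c.finDep_form₀ a) u, ?_⟩,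
    fun a => ⟨- slantForm (c.finDep_form₁ a) u, ?_⟩⟩
  · rw [← fullD_slantForm₀, ← h]
    simp [slantForm_box, form₀_z₀, form₀_z₁]
  · rw [map_neg, ← fullD_slantForm₁, ← h]
    simp [slantForm_box, form₁_z₁, form₁_z₀]

end FiniteContraction

end MixedComplex

/-! ### `∇` as the exterior product of cycles, and its bijectivity. -/

namespace MixedComplex

variable {k : Type u} [Field k] {M : MixedComplex.{u, v} k} {M' : MixedComplex.{u, w} k}

lemma part_apply_eq_zero {P : ℕ → Prop} {x : M.Full} (hx : M.part P x = x) {p : ℕ} (hp : ¬ P p) :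
    x p = 0 := by rw [← hx, M.part_apply_of_not x hp]

lemma part_box {P Q R : ℕ → Prop} (h : ∀ p q, P p → (R (p + q) ↔ Q q)) {x : M.Full}
    (hx : M.part P x = x) (y : M'.Full) :
    (M.tensor M').part R (M.box M' x y) = M.box M' x (M'.part Q y) := by
  funext n ⟨⟨p, q⟩, e⟩
  dsimp only at e
  subst e
  by_cases hp : P p
  · by_cases hq : Q q
    · rw [part_apply_of _ _ ((h p q hp).2 hq), box_apply, box_apply, M'.part_apply_of _ hq]
    · rw [part_apply_of_not _ _ (mt (h p q hp).1 hq), box_apply]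
      dsimp only
      rw [M'.part_apply_of_not _ hq, TensorProduct.tmul_zero]; rfl
  · rw [box_apply]
    dsimp only
    rw [part_apply_eq_zero hx hp, TensorProduct.zero_tmul]
    by_cases hr : R (p + q)
    · rw [part_apply_of _ _ hr, box_apply]
      dsimp only
      rw [part_apply_eq_zero hx hp, TensorProduct.zero_tmul]
    · rw [part_apply_of_not _ _ hr]; rfl

/-- `pairing` truncates `y` to the degrees `Q`, while `box` keeps all of `y`. As `x` is supported in
`P`, components of `y` outside `Q` only reach total degrees outside `R`, so the restriction does not
see them. -/
lemma pairing_res {P Q R : ℕ → Prop} (h : ∀ p q, P p → (R (p + q) ↔ Q q)) {x : M.Full}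
    (hx : M.part P x = x) (y : M'.Full) :
    M.pairing M' P Q R (M.res P x) (M'.res Q y) = (M.tensor M').res R (M.box M' x y) := by
  have h1 : (M.tensor M').res R (M.box M' x (M'.part Q y)) =
      (M.tensor M').res R (M.box M' x y) := by
    rw [← part_box h hx]
    exact res_extZero _ _
  rw [← h1]
  -- With `x` written as its own part in `P`, both sides unfold to the same family.
  nth_rewrite 2 [← hx]
  rfl

/-- The exterior product of cycles. -/
def boxZ (x : LinearMap.ker M.fullD) (y : LinearMap.ker M'.fullD) :
    LinearMap.ker (M.tensor M').fullD :=
  ⟨M.box M' x.1 y.1, by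
    rw [LinearMap.mem_ker, fullD_box, LinearMap.mem_ker.1 x.2, LinearMap.mem_ker.1 y.2]; simp⟩

lemma even_add_iff_of_even (p q : ℕ) (h : Even p) : Even (p + q) ↔ Even q := by
  simp [Nat.even_add, h]

lemma even_add_iff_of_odd (p q : ℕ) (h : Odd p) : Even (p + q) ↔ Odd q := by
  rw [Nat.even_add, ← Nat.not_even_iff_odd]; simp [Nat.not_even_iff_odd.2 h]

lemma odd_add_iff_of_even (p q : ℕ) (h : Even p) : Odd (p + q) ↔ Odd q := by
  simp [Nat.odd_add', h]

lemma odd_add_iff_of_odd (p q : ℕ) (h : Odd p) : Odd (p + q) ↔ Even q := by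
  simp [Nat.odd_add, h]

/-- Purity of `x` is essential: an odd part of `x` would meet the odd part of `y` in even total
degree. The cycle `y` may be mixed, since `x` selects its relevant half. -/
lemma nablaHP₀_inl {x : LinearMap.ker M.fullD} (hx : M.part Even x.1 = x.1)
    (y : LinearMap.ker M'.fullD) :
    M.nablaHP₀ M' (M.cls₀ x ⊗ₜ M'.cls₀ y, 0) = (M.tensor M').cls₀ (boxZ x y) := by
  rw [nablaHP₀, LinearMap.comp_apply, Supercomplex.cross₀, LinearMap.coprod_apply, map_zero,
    add_zero]
  refine congrArg (Submodule.mkQ _) (Subtype.ext (Eq.trans ?_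
    (pairing_res even_add_iff_of_even hx y.1)) :
    (⟨M.nablaChain₀ M' (M.res₀ x.1 ⊗ₜ M'.res₀ y.1, 0), _⟩ :
      LinearMap.ker (M.tensor M').periodic.d₀) = (M.tensor M').resZ₀ (boxZ x y))
  exact (congrArg₂ (· + ·) rfl
    (map_zero (TensorProduct.lift (M.pairing M' Odd Odd Even)))).trans (add_zero _)

lemma nablaHP₀_inr {x : LinearMap.ker M.fullD} (hx : M.part Odd x.1 = x.1)
    (y : LinearMap.ker M'.fullD) :
    M.nablaHP₀ M' (0, M.cls₁ x ⊗ₜ M'.cls₁ y) = (M.tensor M').cls₀ (boxZ x y) := by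
  rw [nablaHP₀, LinearMap.comp_apply, Supercomplex.cross₀, LinearMap.coprod_apply, map_zero,
    zero_add]
  refine congrArg (Submodule.mkQ _) (Subtype.ext (Eq.trans ?_
    (pairing_res even_add_iff_of_odd hx y.1)) :
    (⟨M.nablaChain₀ M' (0, M.res₁ x.1 ⊗ₜ M'.res₁ y.1), _⟩ :
      LinearMap.ker (M.tensor M').periodic.d₀) = (M.tensor M').resZ₀ (boxZ x y))
  exact (congrArg₂ (· + ·)
    (map_zero (TensorProduct.lift (M.pairing M' Even Even Even))) rfl).trans (zero_add _)

lemma nablaHP₁_inl {x : LinearMap.ker M.fullD} (hx : M.part Even x.1 = x.1)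
    (y : LinearMap.ker M'.fullD) :
    M.nablaHP₁ M' (M.cls₀ x ⊗ₜ M'.cls₁ y, 0) = (M.tensor M').cls₁ (boxZ x y) := by
  rw [nablaHP₁, LinearMap.comp_apply, Supercomplex.cross₁, LinearMap.coprod_apply, map_zero,
    add_zero]
  refine congrArg (Submodule.mkQ _) (Subtype.ext (Eq.trans ?_
    (pairing_res odd_add_iff_of_even hx y.1)) :
    (⟨M.nablaChain₁ M' (M.res₀ x.1 ⊗ₜ M'.res₁ y.1, 0), _⟩ :
      LinearMap.ker (M.tensor M').periodic.d₁) = (M.tensor M').resZ₁ (boxZ x y))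
  exact (congrArg₂ (· + ·) rfl
    (map_zero (TensorProduct.lift (M.pairing M' Odd Even Odd)))).trans (add_zero _)

lemma nablaHP₁_inr {x : LinearMap.ker M.fullD} (hx : M.part Odd x.1 = x.1)
    (y : LinearMap.ker M'.fullD) :
    M.nablaHP₁ M' (0, M.cls₁ x ⊗ₜ M'.cls₀ y) = (M.tensor M').cls₁ (boxZ x y) := by
  rw [nablaHP₁, LinearMap.comp_apply, Supercomplex.cross₁, LinearMap.coprod_apply, map_zero,
    zero_add]
  refine congrArg (Submodule.mkQ _) (Subtype.ext (Eq.trans ?_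
    (pairing_res odd_add_iff_of_odd hx y.1)) :
    (⟨M.nablaChain₁ M' (0, M.res₁ x.1 ⊗ₜ M'.res₀ y.1), _⟩ :
      LinearMap.ker (M.tensor M').periodic.d₁) = (M.tensor M').resZ₁ (boxZ x y))
  exact (congrArg₂ (· + ·)
    (map_zero (TensorProduct.lift (M.pairing M' Even Odd Odd))) rfl).trans (zero_add _)

lemma exists_eq_sum_basis_tmul {ι A E : Type*} [Fintype ι] [AddCommGroup A] [Module k A]
    [AddCommGroup E] [Module k E] (β : Module.Basis ι k A) (x : A ⊗[k] E) :
    ∃ e : ι → E, x = ∑ i, β i ⊗ₜ[k] e i := by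
  obtain ⟨e, rfl⟩ := TensorProduct.eq_repr_basis_left β x
  exact ⟨e, Finsupp.sum_fintype _ _ fun i => TensorProduct.tmul_zero _ _⟩

namespace FiniteContraction

variable (M') in
/-- The combination of exterior products with the chosen cycles. -/
def sumBox (c : M.FiniteContraction)
    (y₀ : c.ι₀ → LinearMap.ker M'.fullD) (y₁ : c.ι₁ → LinearMap.ker M'.fullD) :
    LinearMap.ker (M.tensor M').fullD :=
  ∑ a, boxZ (c.z₀ a) (y₀ a) + ∑ a, boxZ (c.z₁ a) (y₁ a)

lemma coe_sumBox (c : M.FiniteContraction)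
    (y₀ : c.ι₀ → LinearMap.ker M'.fullD) (y₁ : c.ι₁ → LinearMap.ker M'.fullD) :
    (c.sumBox M' y₀ y₁).1 =
      ∑ a, M.box M' (c.z₀ a).1 (y₀ a).1 + ∑ a, M.box M' (c.z₁ a).1 (y₁ a).1 := by
  simp [sumBox, boxZ]

lemma nablaHP₀_sum (c : M.FiniteContraction)
    (y₀ : c.ι₀ → LinearMap.ker M'.fullD) (y₁ : c.ι₁ → LinearMap.ker M'.fullD) :
    M.nablaHP₀ M' (∑ a, c.basis₀ a ⊗ₜ M'.cls₀ (y₀ a), ∑ a, c.basis₁ a ⊗ₜ M'.cls₁ (y₁ a)) =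
      (M.tensor M').cls₀ (c.sumBox M' y₀ y₁) := by
  rw [sumBox, map_add, map_sum, map_sum]
  simp_rw [← nablaHP₀_inl (c.part_z₀ _), ← nablaHP₀_inr (c.part_z₁ _), ← map_sum, ← map_add,
    c.cls_z₀, c.cls_z₁]
  congr 1
  ext <;> simp [Prod.fst_sum, Prod.snd_sum]

lemma nablaHP₁_sum (c : M.FiniteContraction)
    (y₀ : c.ι₀ → LinearMap.ker M'.fullD) (y₁ : c.ι₁ → LinearMap.ker M'.fullD) :
    M.nablaHP₁ M' (∑ a, c.basis₀ a ⊗ₜ M'.cls₁ (y₀ a), ∑ a, c.basis₁ a ⊗ₜ M'.cls₀ (y₁ a)) =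
      (M.tensor M').cls₁ (c.sumBox M' y₀ y₁) := by
  rw [sumBox, map_add, map_sum, map_sum]
  simp_rw [← nablaHP₁_inl (c.part_z₀ _), ← nablaHP₁_inr (c.part_z₁ _), ← map_sum, ← map_add,
    c.cls_z₀, c.cls_z₁]
  congr 1
  ext <;> simp [Prod.fst_sum, Prod.snd_sum]

/-- Expanding in the bases of `HP₀(M)` and `HP₁(M)` reduces the claim to sums `∑ z_a ⊠ y_a`, to
which `exists_of_sum_box` and `exists_cycles` apply. -/
theorem nablaHP₀_bijective (c : M.FiniteContraction) : Function.Bijective (M.nablaHP₀ M') := by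
  refine ⟨(injective_iff_map_eq_zero _).2 ?_, fun η => ?_⟩
  · rintro ⟨ξ₀, ξ₁⟩ h
    obtain ⟨e₀, rfl⟩ := exists_eq_sum_basis_tmul c.basis₀ ξ₀
    obtain ⟨e₁, rfl⟩ := exists_eq_sum_basis_tmul c.basis₁ ξ₁
    choose y₀ hy₀ hy₀' using fun a => exists_cls₀_eq (e₀ a)
    choose y₁ hy₁ hy₁' using fun a => exists_cls₁_eq (e₁ a)
    simp_rw [← hy₀', ← hy₁'] at h ⊢
    rw [nablaHP₀_sum, cls₀_eq_zero_iff, coe_sumBox, map_add, map_sum, map_sum] at h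
    -- The `y_a` were chosen of pure parity, so the even part of the sum is the whole sum.
    simp_rw [part_box even_add_iff_of_even (c.part_z₀ _),
      part_box even_add_iff_of_odd (c.part_z₁ _), hy₀, hy₁] at h
    obtain ⟨u, hu⟩ := h
    obtain ⟨h₀, h₁⟩ := c.exists_of_sum_box hu
    have e₀ : ∀ a, M'.cls₀ (y₀ a) = 0 := fun a => (cls₀_eq_zero_iff _).2 (by rw [hy₀]; exact h₀ a)
    have e₁ : ∀ a, M'.cls₁ (y₁ a) = 0 := fun a => (cls₁_eq_zero_iff _).2 (by rw [hy₁]; exact h₁ a)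
    simp [e₀, e₁]
  · obtain ⟨w, hw, rfl⟩ := exists_cls₀_eq η
    obtain ⟨y₀, y₁, u, hu⟩ := c.exists_cycles (LinearMap.mem_ker.1 w.2)
    -- These `y_a` may have mixed parity: the classes `cls₀` and `cls₁` retain only the halves that
    -- matter in even total degree.
    refine ⟨_, (c.nablaHP₀_sum y₀ y₁).trans (Eq.symm ?_)⟩
    rw [← sub_eq_zero, ← map_sub, cls₀_eq_zero_iff, Submodule.coe_sub, coe_sumBox, hu]
    exact ⟨_, (fullD_part_odd _ u).symm⟩

theorem nablaHP₁_bijective (c : M.FiniteContraction) : Function.Bijective (M.nablaHP₁ M') := by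
  refine ⟨(injective_iff_map_eq_zero _).2 ?_, fun η => ?_⟩
  · rintro ⟨ξ₀, ξ₁⟩ h
    obtain ⟨e₀, rfl⟩ := exists_eq_sum_basis_tmul c.basis₀ ξ₀
    obtain ⟨e₁, rfl⟩ := exists_eq_sum_basis_tmul c.basis₁ ξ₁
    choose y₀ hy₀ hy₀' using fun a => exists_cls₁_eq (e₀ a)
    choose y₁ hy₁ hy₁' using fun a => exists_cls₀_eq (e₁ a)
    simp_rw [← hy₀', ← hy₁'] at h ⊢
    rw [nablaHP₁_sum, cls₁_eq_zero_iff, coe_sumBox, map_add, map_sum, map_sum] at h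
    -- In odd total degree the parities of the `y_a` are exchanged: odd against `z₀`, even against
    -- `z₁`.
    simp_rw [part_box odd_add_iff_of_even (c.part_z₀ _),
      part_box odd_add_iff_of_odd (c.part_z₁ _), hy₀, hy₁] at h
    obtain ⟨u, hu⟩ := h
    obtain ⟨h₀, h₁⟩ := c.exists_of_sum_box hu
    have e₀ : ∀ a, M'.cls₁ (y₀ a) = 0 := fun a => (cls₁_eq_zero_iff _).2 (by rw [hy₀]; exact h₀ a)
    have e₁ : ∀ a, M'.cls₀ (y₁ a) = 0 := fun a => (cls₀_eq_zero_iff _).2 (by rw [hy₁]; exact h₁ a)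
    simp [e₀, e₁]
  · obtain ⟨w, hw, rfl⟩ := exists_cls₁_eq η
    obtain ⟨y₀, y₁, u, hu⟩ := c.exists_cycles (LinearMap.mem_ker.1 w.2)
    refine ⟨_, (c.nablaHP₁_sum y₀ y₁).trans (Eq.symm ?_)⟩
    rw [← sub_eq_zero, ← map_sub, cls₁_eq_zero_iff, Submodule.coe_sub, coe_sumBox, hu]
    exact ⟨_, (fullD_part_even _ u).symm⟩

end FiniteContraction

/-- The Künneth isomorphism in periodic cyclic homology, for mixed complexes. -/
theorem IsMittagLeffler.nablaHP_bijective (h : M.IsMittagLeffler)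
    (hfin : FiniteDimensional k (M.HP₀ × M.HP₁)) (M' : MixedComplex.{u, w} k) :
    Function.Bijective (M.nablaHP₀ M') ∧ Function.Bijective (M.nablaHP₁ M') := by
  have : FiniteDimensional k M.HP₀ :=
    Module.Finite.of_surjective (LinearMap.fst k M.HP₀ M.HP₁) LinearMap.fst_surjective
  have : FiniteDimensional k M.HP₁ :=
    Module.Finite.of_surjective (LinearMap.snd k M.HP₀ M.HP₁) LinearMap.snd_surjective
  obtain ⟨c⟩ := h.nonempty_finiteContraction
  exact ⟨c.nablaHP₀_bijective, c.nablaHP₁_bijective⟩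

end MixedComplex

end

theorem mainTheorem7 {k : Type u} [Field k] (C : CyclicModule.{u, v} k) :
    -- the Künneth isomorphism, with all complexes normalized
    (C.normalizedMixedComplex.IsMittagLeffler →
      FiniteDimensional k (C.normalizedMixedComplex.HP₀ × C.normalizedMixedComplex.HP₁) →
      ∀ C' : CyclicModule.{u, w} k,
        (∃ e : ((C.normalizedMixedComplex.HP₀ ⊗[k] C'.normalizedMixedComplex.HP₀) ×
              (C.normalizedMixedComplex.HP₁ ⊗[k] C'.normalizedMixedComplex.HP₁)) ≃ₗ[k]
              (C.normalizedMixedComplex.tensor C'.normalizedMixedComplex).HP₀,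
          e.toLinearMap = C.normalizedMixedComplex.nablaHP₀ C'.normalizedMixedComplex) ∧
        (∃ e : ((C.normalizedMixedComplex.HP₀ ⊗[k] C'.normalizedMixedComplex.HP₁) ×
              (C.normalizedMixedComplex.HP₁ ⊗[k] C'.normalizedMixedComplex.HP₀)) ≃ₗ[k]
              (C.normalizedMixedComplex.tensor C'.normalizedMixedComplex).HP₁,
          e.toLinearMap = C.normalizedMixedComplex.nablaHP₁ C'.normalizedMixedComplex)) ∧
    -- the same, with all complexes unnormalized
    (C.mixedComplex.IsMittagLeffler →
      FiniteDimensional k (C.mixedComplex.HP₀ × C.mixedComplex.HP₁) →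
      ∀ C' : CyclicModule.{u, w} k,
        (∃ e : ((C.mixedComplex.HP₀ ⊗[k] C'.mixedComplex.HP₀) ×
              (C.mixedComplex.HP₁ ⊗[k] C'.mixedComplex.HP₁)) ≃ₗ[k]
              (C.mixedComplex.tensor C'.mixedComplex).HP₀,
          e.toLinearMap = C.mixedComplex.nablaHP₀ C'.mixedComplex) ∧
        (∃ e : ((C.mixedComplex.HP₀ ⊗[k] C'.mixedComplex.HP₁) ×
              (C.mixedComplex.HP₁ ⊗[k] C'.mixedComplex.HP₀)) ≃ₗ[k]
              (C.mixedComplex.tensor C'.mixedComplex).HP₁,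
          e.toLinearMap = C.mixedComplex.nablaHP₁ C'.mixedComplex)) := by
  -- Both cases are instances of the statement for mixed complexes; the cyclic structure enters only
  -- through their construction.
  refine ⟨fun h hfin C' => ?_, fun h hfin C' => ?_⟩ <;>
  exact ⟨⟨LinearEquiv.ofBijective _ (h.nablaHP_bijective hfin _).1, rfl⟩,
    ⟨LinearEquiv.ofBijective _ (h.nablaHP_bijective hfin _).2, rfl⟩⟩
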